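/- Let $M$ be a compact complex manifold of complex dimension $n$ with a smooth Hermitian metric $g$, and let $\omega=\sqrt{-1}\sum_{i,j} g_{i\bar j}\,dz^i\wedge d\bar z^j$ be the associated real $(1,1)$-form. Assume that either (a) $n=2$, or (b) $n>2$ and $g$ is balanced, i.e. $d(\omega^{n-1})=0$. Write $\Delta f=g^{i\bar j}\partial_i\partial_{\bar j}f$ for the Laplacian of the Chern connection of $g$. Then for every real number $K$ there exist constants $C>0$ and $A>0$, depending only on $(M,g)$ and $K$, with the following property. Let $F$ be a smooth real-valued function on $M$ with $|F|\le K$ and $|\Delta F|\le K$ on $M$, and let $\varphi$ be a smooth real-valued function on $M$ with $\sup_M\varphi=0$ that solves the complex Monge–Ampère equation $$(\omega+\sqrt{-1}\,\partial\bar\partial\varphi)^n=e^F\omega^n,\qquad \omega+\sqrt{-1}\,\partial\bar\partial\varphi>0 .$$ Let $g'$ be the Hermitian metric $g'_{i\bar j}=g_{i\bar j}+\partial_i\partial_{\bar j}\varphi$ and let $\mathrm{tr}_g g'=g^{i\bar j}g'_{i\bar j}$. Then $$\mathrm{tr}_g g'\le C\,e^{A(\varphi-\inf_M\varphi)}\qquad\text{on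 } M .$$ -/

import Mathlib

open Set Function
open scoped Manifold ContDiff Matrix ComplexConjugate ComplexOrder

noncomputable section

namespace HermitianMA

/-- Model space `ℂⁿ`. -/
abbrev Cn (n : ℕ) : Type := Fin n → ℂ

/-- Complex-valued real-multilinear alternating `k`-forms on `ℂⁿ`, i.e. complex-valued covectors
of degree `k` on the underlying real vector space. -/
abbrev CForm (n k : ℕ) : Type := Cn n [⋀^Fin k]→L[ℝ] ℂ

/-! ### Exterior algebra -/

/-- The tensor product `(v₁,…,v_{p+q}) ↦ α(v₁,…,v_p) β(v_{p+1},…,v_{p+q})`. -/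
def tensor {n p q : ℕ} (α : CForm n p) (β : CForm n q) :
    ContinuousMultilinearMap ℝ (fun _ : Fin (p + q) => Cn n) ℂ where
  toFun v := α (fun i => v (Fin.castAdd q i)) * β (fun j => v (Fin.natAdd p j))
  map_update_add' := by
    intro hd m i x y
    obtain rfl : hd = instDecidableEqFin (p + q) := Subsingleton.elim _ _
    have hl : ∀ (k : Fin p) (z : Cn n), (fun i => update m (Fin.castAdd q k) z (Fin.castAdd q i))
        = update (fun i => m (Fin.castAdd q i)) k z := fun k z =>
      update_comp_eq_of_injective m (Fin.castAdd_injective p q) k z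
    have hr : ∀ (k : Fin q) (z : Cn n), (fun i => update m (Fin.natAdd p k) z (Fin.natAdd p i))
        = update (fun i => m (Fin.natAdd p i)) k z := fun k z =>
      update_comp_eq_of_injective m (Fin.natAdd_injective q p) k z
    refine Fin.addCases (fun k => ?_) (fun k => ?_) i
    · have hne : ∀ j : Fin q, Fin.natAdd p j ≠ Fin.castAdd q k := fun j h => by
        have := congrArg Fin.val h; simp at this; omega
      simp only [hl, ContinuousAlternatingMap.map_update_add, update_of_ne (hne _), add_mul]
    · have hne : ∀ j : Fin p, Fin.castAdd q j ≠ Fin.natAdd p k := fun j h => by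
        have := congrArg Fin.val h; simp at this; omega
      simp only [hr, ContinuousAlternatingMap.map_update_add, update_of_ne (hne _), mul_add]
  map_update_smul' := by
    intro hd m i c x
    obtain rfl : hd = instDecidableEqFin (p + q) := Subsingleton.elim _ _
    have hl : ∀ (k : Fin p) (z : Cn n), (fun i => update m (Fin.castAdd q k) z (Fin.castAdd q i))
        = update (fun i => m (Fin.castAdd q i)) k z := fun k z =>
      update_comp_eq_of_injective m (Fin.castAdd_injective p q) k z
    have hr : ∀ (k : Fin q) (z : Cn n), (fun i => update m (Fin.natAdd p k) z (Fin.natAdd p i))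
        = update (fun i => m (Fin.natAdd p i)) k z := fun k z =>
      update_comp_eq_of_injective m (Fin.natAdd_injective q p) k z
    refine Fin.addCases (fun k => ?_) (fun k => ?_) i
    · have hne : ∀ j : Fin q, Fin.natAdd p j ≠ Fin.castAdd q k := fun j h => by
        have := congrArg Fin.val h; simp at this; omega
      simp only [hl, ContinuousAlternatingMap.map_update_smul, update_of_ne (hne _), smul_mul_assoc]
    · have hne : ∀ j : Fin p, Fin.castAdd q j ≠ Fin.natAdd p k := fun j h => by
        have := congrArg Fin.val h; simp at this; omega
      simp only [hr, ContinuousAlternatingMap.map_update_smul, update_of_ne (hne _), mul_smul_comm]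
  cont := by
    refine Continuous.mul ?_ ?_
    · exact α.cont.comp (continuous_pi fun i => continuous_apply _)
    · exact β.cont.comp (continuous_pi fun i => continuous_apply _)

/-- The wedge product, normalized so that
`(α ∧ β)(v) = (p! q!)⁻¹ ∑_σ sgn(σ) α(v_{σ(1)},…,v_{σ(p)}) β(v_{σ(p+1)},…,v_{σ(p+q)})`. -/
def wedge {n p q : ℕ} (α : CForm n p) (β : CForm n q) : CForm n (p + q) :=
  ((p.factorial * q.factorial : ℝ)⁻¹) • ContinuousMultilinearMap.alternatization (tensor α β)

/-- The wedge powers `α ∧ ⋯ ∧ α` (`k` factors) of a `2`-form. -/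
def wedgePow {n : ℕ} (α : CForm n 2) : (k : ℕ) → CForm n (2 * k)
  | 0 => ContinuousAlternatingMap.constOfIsEmpty ℝ (Cn n) (Fin 0) 1
  | k + 1 => wedge (wedgePow α k) α

/-- The `1`-form `dzⁱ`. -/
def dz {n : ℕ} (i : Fin n) : CForm n 1 :=
  ContinuousAlternatingMap.ofSubsingleton ℝ (Cn n) ℂ (0 : Fin 1)
    (ContinuousLinearMap.proj (R := ℝ) (φ := fun _ : Fin n => ℂ) i)

/-- The `1`-form `dz̄ⁱ`. -/
def dzbar {n : ℕ} (i : Fin n) : CForm n 1 :=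
  ContinuousAlternatingMap.ofSubsingleton ℝ (Cn n) ℂ (0 : Fin 1)
    ((Complex.conjCLE : ℂ →L[ℝ] ℂ).comp
      (ContinuousLinearMap.proj (R := ℝ) (φ := fun _ : Fin n => ℂ) i))

/-- The `(1,1)`-form `√-1 ∑ᵢⱼ Hᵢⱼ dzⁱ ∧ dz̄ʲ` with coefficient matrix `H`. -/
def formOfMatrix {n : ℕ} (H : Matrix (Fin n) (Fin n) ℂ) : CForm n 2 :=
  Complex.I • ∑ i, ∑ j, H i j • wedge (dz i) (dzbar j)

/-! ### Wirtinger derivatives -/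

/-- `∂f/∂zⁱ = ½ (∂f/∂xⁱ - √-1 ∂f/∂yⁱ)`. -/
def dWirt {n : ℕ} (i : Fin n) (f : Cn n → ℂ) (z : Cn n) : ℂ :=
  (1 / 2) * (fderiv ℝ f z (Pi.single i 1) - Complex.I * fderiv ℝ f z (Pi.single i Complex.I))

/-- `∂f/∂z̄ⁱ = ½ (∂f/∂xⁱ + √-1 ∂f/∂yⁱ)`. -/
def dbarWirt {n : ℕ} (i : Fin n) (f : Cn n → ℂ) (z : Cn n) : ℂ :=
  (1 / 2) * (fderiv ℝ f z (Pi.single i 1) + Complex.I * fderiv ℝ f z (Pi.single i Complex.I))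

/-! ### Hermitian metrics on complex manifolds -/

section Manifold

variable {n : ℕ} {M : Type*} [TopologicalSpace M] [ChartedSpace (Cn n) M]

/-- The holomorphic coordinate charts of `M`. -/
def holCharts (n : ℕ) (M : Type*) [TopologicalSpace M] [ChartedSpace (Cn n) M] :
    Set (OpenPartialHomeomorph M (Cn n)) :=
  IsManifold.maximalAtlas 𝓘(ℂ, Cn n) ω M

/-- The coordinate vector field `∂/∂zⁱ` of the chart `e`, at the point with coordinates `z`. -/
def coordVec (e : OpenPartialHomeomorph M (Cn n)) (z : Cn n) (i : Fin n) :
    TangentSpace 𝓘(ℂ, Cn n) (e.symm z) :=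
  mfderiv 𝓘(ℂ, Cn n) 𝓘(ℂ, Cn n) e.symm z (Pi.single i (1 : ℂ) : Cn n)

/-- A (smooth) Hermitian metric on the complex manifold `M`: a positive definite Hermitian form on
each holomorphic tangent space, linear in the first and conjugate-linear in the second variable,
whose coefficients in holomorphic coordinates are smooth in the real sense. -/
structure HermitianMetric (n : ℕ) (M : Type*) [TopologicalSpace M] [ChartedSpace (Cn n) M] where
  form : ∀ x : M, TangentSpace 𝓘(ℂ, Cn n) x →ₗ[ℂ] TangentSpace 𝓘(ℂ, Cn n) x →ₗ⋆[ℂ] ℂ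
  symm : ∀ x v w, form x w v = conj (form x v w)
  pos : ∀ x v, v ≠ 0 → 0 < (form x v v).re
  smooth : ∀ e ∈ holCharts n M, ∀ i j : Fin n,
    ContDiffOn ℝ ∞ (fun z => form (e.symm z) (coordVec e z i) (coordVec e z j)) e.target

/-- The complex Hessian `(∂ᵢ∂_{j̄} f)` of a real function in the chart `e`. -/
def complexHessian (e : OpenPartialHomeomorph M (Cn n)) (f : M → ℝ) (z : Cn n) :
    Matrix (Fin n) (Fin n) ℂ :=
  Matrix.of fun i j => dWirt i (dbarWirt j fun w => (f (e.symm w) : ℂ)) z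

namespace HermitianMetric

variable (g : HermitianMetric n M)

/-- The coefficients `g_{i j̄}` in the chart `e`. -/
def coeff (e : OpenPartialHomeomorph M (Cn n)) (z : Cn n) : Matrix (Fin n) (Fin n) ℂ :=
  Matrix.of fun i j => g.form (e.symm z) (coordVec e z i) (coordVec e z j)

/-- The coefficients `g'_{i j̄} = g_{i j̄} + ∂ᵢ∂_{j̄} φ` in the chart `e`. -/
def coeff' (φ : M → ℝ) (e : OpenPartialHomeomorph M (Cn n)) (z : Cn n) :
    Matrix (Fin n) (Fin n) ℂ :=
  g.coeff e z + complexHessian e φ z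

/-- The metric is balanced: the `(n-1)`-st power of its associated form
`√-1 ∑ g_{i j̄} dzⁱ ∧ dz̄ʲ` is closed. -/
def IsBalanced : Prop :=
  ∀ e ∈ holCharts n M, ∀ z ∈ e.target,
    extDeriv (fun w => wedgePow (formOfMatrix (g.coeff e w)) (n - 1)) z = 0

/-- `φ` solves `(ω + √-1 ∂∂̄φ)ⁿ = e^F ωⁿ` with `ω + √-1 ∂∂̄φ > 0`, where
`ω = √-1 ∑ g_{i j̄} dzⁱ ∧ dz̄ʲ`. -/
def SolvesMongeAmpere (F φ : M → ℝ) : Prop :=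
  ∀ e ∈ holCharts n M, ∀ z ∈ e.target,
    (g.coeff' φ e z).PosDef ∧
    wedgePow (formOfMatrix (g.coeff' φ e z)) n =
      (Real.exp (F (e.symm z)) : ℂ) • wedgePow (formOfMatrix (g.coeff e z)) n

/-- The trace `g^{i j̄} H_{i j̄}` in the chart `e`; it is real when `H` is Hermitian. -/
def traceIn (e : OpenPartialHomeomorph M (Cn n)) (z : Cn n) (H : Matrix (Fin n) (Fin n) ℂ) : ℝ :=
  ((g.coeff e z)⁻¹ * H).trace.re

/-- The Chern Laplacian `Δf = g^{i j̄} ∂ᵢ∂_{j̄} f` in the chart `e`. -/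
def laplacianIn (e : OpenPartialHomeomorph M (Cn n)) (f : M → ℝ) (z : Cn n) : ℝ :=
  g.traceIn e z (complexHessian e f z)

/-- `tr_g g' = g^{i j̄} g'_{i j̄}` in the chart `e`. -/
def traceMetricIn (e : OpenPartialHomeomorph M (Cn n)) (φ : M → ℝ) (z : Cn n) : ℝ :=
  g.traceIn e z (g.coeff' φ e z)

end HermitianMetric

end Manifold

end HermitianMA

end

/-!
On a general Hermitian manifold the Laplacian of `log tr_g g'` with respect to `g'` is bounded below
by `-C tr_{g'} g`, up to a term pairing the gradient of `tr_g g'` with the trace of the torsion of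
`g`. At a maximum point of
`log tr_g g' - A φ + 1 / (φ - inf φ + 1)`
the gradient of `tr_g g'` is a multiple of that of `φ`. The Hessian of the last summand contributes
`2 (φ - inf φ + 1)⁻³ |∂φ|²`, and by AM–GM this absorbs the torsion term as soon as `tr_g g'` is
large compared with `(φ - inf φ + 1)^{3/2}`. For large `A` the maximum principle then bounds
`tr_{g'} g`, and the equation `det g' = e^F det g` turns this into a bound for `tr_g g'`. Hence at
the maximum point `tr_g g'` is at most a multiple of `(φ - inf φ + 1)²`, which the exponential
dominates.
-/

noncomputable section

namespace HermitianMA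

open Complex
open scoped Ring

/-! ### The maximum principle on jets -/

section WeightedSums

lemma re_conj_mul_le {a b : ℂ} {x y : ℝ} (ha : ‖a‖ ≤ x) (hb : ‖b‖ ≤ y) :
    (conj a * b).re ≤ x * y :=
  calc (conj a * b).re ≤ ‖conj a * b‖ := re_le_norm _
    _ = ‖a‖ * ‖b‖ := by rw [norm_mul, RCLike.norm_conj]
    _ ≤ x * y := mul_le_mul ha hb (norm_nonneg _) ((norm_nonneg _).trans ha)

lemma normSq_le_sq {a : ℂ} {x : ℝ} (ha : ‖a‖ ≤ x) : normSq a ≤ x ^ 2 := by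
  rw [normSq_eq_norm_sq]
  exact pow_le_pow_left₀ (norm_nonneg _) ha 2

lemma normSq_sub_two_re_mul_conj_le (u b : ℂ) :
    normSq u - 2 * (u * conj b).re ≤ normSq (u - b) := by
  rw [normSq_sub]
  linarith [normSq_nonneg b]

lemma normSq_div_sub_two_re (h g : ℂ) {l : ℝ} (hl : 0 < l) :
    normSq h / l - 2 * (conj g * h).re = normSq (h - g * l) / l - normSq g * l := by
  simp only [normSq_apply, mul_re, conj_re, conj_im, sub_re, sub_im, mul_im, ofReal_re, ofReal_im]
  field_simp
  ring

lemma normSq_div_sub_two_re_ge {h g t : ℂ} {l B : ℝ} (hl : 0 < l) (hg : ‖g‖ ≤ B)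
    (ht : ‖t‖ ≤ 2 * B) :
    normSq (h - g * l) / l - (B ^ 2 * l + 4 * B ^ 2) ≤
      normSq h / l - 2 * (conj g * (h + t)).re := by
  have hsq := normSq_div_sub_two_re h g hl
  have htg := re_conj_mul_le hg ht
  have hgl := mul_le_mul_of_nonneg_right (normSq_le_sq hg) hl.le
  rw [mul_add, add_re]
  linarith

variable {ι : Type*} [Fintype ι] {x : ι → ℝ}

lemma normSq_sum_le_sum_mul_sum_div (a : ι → ℂ) (hx : ∀ i, 0 < x i) :
    normSq (∑ i, a i) ≤ (∑ i, x i) * ∑ i, normSq (a i) / x i := by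
  have cauchy_schwarz : (∑ i, ‖a i‖) ^ 2 ≤ (∑ i, x i) * ∑ i, normSq (a i) / x i :=
    Finset.sum_sq_le_sum_mul_sum_of_sq_le_mul Finset.univ (fun i _ => (hx i).le)
      (fun i _ => div_nonneg (normSq_nonneg _) (hx i).le)
      (fun i _ => by rw [normSq_eq_norm_sq, mul_div_cancel₀ _ (hx i).ne'])
  rw [normSq_eq_norm_sq]
  exact (pow_le_pow_left₀ (norm_nonneg _) (norm_sum_le _ _) 2).trans cauchy_schwarz

lemma le_sum_of_le_prod [Nonempty ι] (hx : ∀ i, 0 < x i) {c : ℝ} (hc : c ≤ 1)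
    (hprod : c ≤ ∏ i, x i) : c ≤ ∑ i, x i := by
  rcases le_or_gt 1 (∑ i, x i) with h | h
  · exact hc.trans h
  have hnonneg : 0 ≤ ∑ i, x i := Finset.sum_nonneg fun i _ => (hx i).le
  calc c ≤ ∏ i, x i := hprod
    _ ≤ ∏ _i : ι, ∑ j, x j := Finset.prod_le_prod (fun i _ => (hx i).le) fun i hi =>
        Finset.single_le_sum (fun j _ => (hx j).le) hi
    _ = (∑ j, x j) ^ Fintype.card ι := by rw [Finset.prod_const, Finset.card_univ]
    _ ≤ ∑ j, x j := pow_le_of_le_one hnonneg h.le Fintype.card_ne_zero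

/-- `xᵢ` is the product of all `xⱼ` and of the inverses of the others. -/
lemma sum_le_of_sum_inv_le (hx : ∀ i, 0 < x i) {c T : ℝ} (hprod : ∏ i, x i ≤ c)
    (hT : ∑ i, (x i)⁻¹ ≤ T) : ∑ i, x i ≤ Fintype.card ι * (c * (1 + T) ^ Fintype.card ι) := by
  classical
  have hinv : ∀ i, 0 ≤ (x i)⁻¹ := fun i => (inv_pos.2 (hx i)).le
  have hT0 : 0 ≤ T := (Finset.sum_nonneg fun i _ => hinv i).trans hT
  have hle : ∀ i, (x i)⁻¹ ≤ 1 + T := fun i => by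
    linarith [Finset.single_le_sum (fun j _ => hinv j) (Finset.mem_univ i)]
  have h : ∀ i, x i ≤ c * (1 + T) ^ Fintype.card ι := fun i => by
    calc x i = (∏ j, x j) * ∏ j ∈ Finset.univ.erase i, (x j)⁻¹ := by
          rw [← Finset.mul_prod_erase _ _ (Finset.mem_univ i), mul_assoc, ← Finset.prod_mul_distrib]
          simp [(hx _).ne']
      _ ≤ c * ∏ _j ∈ Finset.univ.erase i, (1 + T) :=
          mul_le_mul hprod (Finset.prod_le_prod (fun j _ => hinv j) fun j _ => hle j)
            (Finset.prod_nonneg fun j _ => hinv j)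
            ((Finset.prod_nonneg fun j _ => (hx j).le).trans hprod)
      _ ≤ c * (1 + T) ^ Fintype.card ι := by
          rw [Finset.prod_const]
          gcongr
          · exact (Finset.prod_nonneg fun j _ => (hx j).le).trans hprod
          · linarith
          · exact Finset.card_le_univ _
  calc ∑ i, x i ≤ ∑ _i : ι, c * (1 + T) ^ Fintype.card ι := Finset.sum_le_sum fun i _ => h i
    _ = _ := by rw [Finset.sum_const, Finset.card_univ, nsmul_eq_mul]

end WeightedSums

/-- The derivatives at one point of two metrics `g` and `g' = g + ∂∂̄φ` with `det g' = e^F det g`,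
in a frame in which `g` is the identity and `g'` is diagonal with entries `eig`. Only the
derivatives that enter the Laplacian of `tr_g g'` are recorded: `dg i k l = ∂ᵢ g_{k l̄}`,
`ddg i k = ∂ᵢ∂_{ī} g_{k k̄}`, likewise `dg'` and `ddg'` for `g'`, and `ddF i = ∂ᵢ∂_{ī} F`. -/
structure MongeAmpereJet (ι : Type*) [Fintype ι] where
  eig : ι → ℝ
  dg : ι → ι → ι → ℂ
  dg' : ι → ι → ι → ℂ
  ddg : ι → ι → ℝ
  ddg' : ι → ι → ℝ
  F : ℝ
  ddF : ι → ℝ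
  eig_pos : ∀ i, 0 < eig i
  torsion_eq : ∀ i k l, dg' i k l - dg' k i l = dg i k l - dg k i l
  ddg_sub_ddg : ∀ i k, ddg' i k - ddg' k i = ddg i k - ddg k i
  prod_eig : ∏ i, eig i = Real.exp F
  ddlogdet_eq : ∀ k,
    ∑ i, ddg' k i / eig i - ∑ i, ∑ l, normSq (dg' k i l) / (eig i * eig l) =
      ddF k + ∑ i, ddg k i - ∑ i, ∑ l, normSq (dg k i l)

namespace MongeAmpereJet

variable {ι : Type*} [Fintype ι] (J : MongeAmpereJet ι)

/-- `tr_g g'`. -/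
def tr : ℝ := ∑ i, J.eig i

/-- `tr_{g'} g`. -/
def trInv : ℝ := ∑ i, (J.eig i)⁻¹

/-- `∂ᵢ tr_g g'`. -/
def dtr (i : ι) : ℂ := ∑ k, (J.dg' i k k - J.dg i k k * J.eig k)

/-- `∂ᵢ∂_{ī} tr_g g'`. -/
def ddtr (i : ι) : ℝ :=
  ∑ k, J.ddg' i k - ∑ k, ∑ l, 2 * (conj (J.dg i k l) * J.dg' i k l).re +
    ∑ k, J.eig k * (∑ l, normSq (J.dg i k l) + ∑ l, normSq (J.dg i l k) - J.ddg i k)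

/-- The trace of the torsion of `g`. -/
def torsionTr (i : ι) : ℂ := ∑ k, (J.dg i k k - J.dg k i k)

/-- A bound for the first and second derivatives of `g`. -/
def BoundedBy (B : ℝ) : Prop := (∀ i k l, ‖J.dg i k l‖ ≤ B) ∧ ∀ i k, |J.ddg i k| ≤ B

variable {J} {B K : ℝ}

lemma sum_dg'_sub_eq_dtr_sub_torsionTr (i : ι) :
    ∑ k, (J.dg' k i k - J.dg i k k * J.eig k) = J.dtr i - J.torsionTr i := by
  rw [dtr, torsionTr, ← Finset.sum_sub_distrib]
  refine Finset.sum_congr rfl fun k _ => ?_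
  rw [← J.torsion_eq]
  ring

lemma norm_torsionTr_le (hB : J.BoundedBy B) (i : ι) :
    ‖J.torsionTr i‖ ≤ 2 * Fintype.card ι * B :=
  calc ‖J.torsionTr i‖ ≤ ∑ _k : ι, 2 * B :=
        norm_sum_le_of_le _ fun k _ => (norm_sub_le _ _).trans (by
          linarith [hB.1 i k k, hB.1 k i k])
    _ = 2 * Fintype.card ι * B := by
        rw [Finset.sum_const, Finset.card_univ, nsmul_eq_mul]
        ring

lemma normSq_dtr_div_tr_le [Nonempty ι] :
    (∑ i, normSq (J.dtr i) / J.eig i - 2 * ∑ i, (J.dtr i * conj (J.torsionTr i)).re / J.eig i)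
        / J.tr ≤
      ∑ i, ∑ k, normSq (J.dg' k i k - J.dg i k k * J.eig k) / (J.eig i * J.eig k) := by
  rw [div_le_iff₀ (show 0 < J.tr from Finset.sum_pos (fun i _ => J.eig_pos i)
    Finset.univ_nonempty), Finset.mul_sum, ← Finset.sum_sub_distrib, Finset.sum_mul]
  refine Finset.sum_le_sum fun i _ => ?_
  set Z : ι → ℂ := fun k => J.dg' k i k - J.dg i k k * J.eig k
  have hZ : normSq (J.dtr i) - 2 * (J.dtr i * conj (J.torsionTr i)).re ≤
      J.tr * ∑ k, normSq (Z k) / J.eig k :=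
    calc _ ≤ normSq (J.dtr i - J.torsionTr i) := normSq_sub_two_re_mul_conj_le _ _
      _ = normSq (∑ k, Z k) := by rw [sum_dg'_sub_eq_dtr_sub_torsionTr]
      _ ≤ _ := normSq_sum_le_sum_mul_sum_div Z J.eig_pos
  calc normSq (J.dtr i) / J.eig i - 2 * ((J.dtr i * conj (J.torsionTr i)).re / J.eig i)
      = (normSq (J.dtr i) - 2 * (J.dtr i * conj (J.torsionTr i)).re) / J.eig i := by ring
    _ ≤ (J.tr * ∑ k, normSq (Z k) / J.eig k) / J.eig i :=
        div_le_div_of_nonneg_right hZ (J.eig_pos i).le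
    _ = (∑ k, normSq (Z k) / (J.eig i * J.eig k)) * J.tr := by
        rw [mul_comm, mul_div_right_comm, Finset.sum_div]
        simp only [div_div, mul_comm]

/-- The diagonal terms `k = l` are kept, as they dominate the gradient of the trace. -/
lemma third_order_term_ge [DecidableEq ι] (hB : J.BoundedBy B) (i k l : ι) :
    (if k = l then normSq (J.dg' k i k - J.dg i k k * J.eig k) / (J.eig i * J.eig k) else 0)
      - (B ^ 2 * (J.eig l * (J.eig i)⁻¹) + 4 * B ^ 2 * (J.eig i)⁻¹) ≤
      normSq (J.dg' k i l) / (J.eig i * J.eig l)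
        - 2 * (conj (J.dg i k l) * J.dg' i k l).re / J.eig i := by
  have hi := J.eig_pos i
  have hl := J.eig_pos l
  have hsquare : normSq (J.dg' k i l - J.dg i k l * J.eig l) / J.eig l
      - (B ^ 2 * J.eig l + 4 * B ^ 2) ≤
      normSq (J.dg' k i l) / J.eig l - 2 * (conj (J.dg i k l) * J.dg' i k l).re := by
    have htorsion : ‖J.dg i k l - J.dg k i l‖ ≤ 2 * B :=
      (norm_sub_le _ _).trans (by linarith [hB.1 i k l, hB.1 k i l])
    convert normSq_div_sub_two_re_ge (h := J.dg' k i l) hl (hB.1 i k l) htorsion using 5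
    rw [← J.torsion_eq, add_sub_cancel]
  calc _ ≤ normSq (J.dg' k i l - J.dg i k l * J.eig l) / (J.eig i * J.eig l)
        - (B ^ 2 * (J.eig l * (J.eig i)⁻¹) + 4 * B ^ 2 * (J.eig i)⁻¹) := by
        gcongr
        split_ifs with hkl
        · rw [hkl]
        · exact div_nonneg (normSq_nonneg _) (mul_pos hi hl).le
    _ = (normSq (J.dg' k i l - J.dg i k l * J.eig l) / J.eig l
        - (B ^ 2 * J.eig l + 4 * B ^ 2)) / J.eig i := by field_simp
    _ ≤ (normSq (J.dg' k i l) / J.eig l - 2 * (conj (J.dg i k l) * J.dg' i k l).re) / J.eig i :=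
        div_le_div_of_nonneg_right hsquare hi.le
    _ = _ := by field_simp

lemma third_order_ge (hB : J.BoundedBy B) :
    ∑ i, ∑ k, normSq (J.dg' k i k - J.dg i k k * J.eig k) / (J.eig i * J.eig k)
      - (Fintype.card ι * B ^ 2 * J.tr * J.trInv
        + 4 * (Fintype.card ι) ^ 2 * B ^ 2 * J.trInv) ≤
      ∑ i, ∑ k, ∑ l, normSq (J.dg' k i l) / (J.eig i * J.eig l)
        - ∑ i, ∑ k, ∑ l, 2 * (conj (J.dg i k l) * J.dg' i k l).re / J.eig i := by
  classical
  have hsum := Finset.sum_le_sum fun i (_ : i ∈ Finset.univ) =>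
    Finset.sum_le_sum fun k (_ : k ∈ Finset.univ) =>
      Finset.sum_le_sum fun l (_ : l ∈ Finset.univ) => third_order_term_ge hB i k l
  simp only [Finset.sum_sub_distrib, Finset.sum_add_distrib, ← Finset.mul_sum, Finset.sum_ite_eq,
    Finset.mem_univ, if_true, Finset.sum_const, Finset.card_univ, nsmul_eq_mul,
    ← Finset.sum_mul] at hsum
  refine le_trans (le_of_eq ?_) (hsum.trans (le_of_eq ?_))
  · rw [tr, trInv]; ring
  · simp only [← Finset.mul_sum, mul_div_assoc]

/-- The equation for `log det g'` turns the fourth derivatives of `φ` into lower order ones. -/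
lemma sum_ddtr_div_eig :
    ∑ i, J.ddtr i / J.eig i =
      ∑ k, J.ddF k + ∑ k, ∑ i, J.ddg k i - ∑ k, ∑ i, ∑ l, normSq (J.dg k i l)
      + ∑ i, ∑ k, (J.ddg i k - J.ddg k i) / J.eig i
      + (∑ i, ∑ k, ∑ l, normSq (J.dg' k i l) / (J.eig i * J.eig l)
        - ∑ i, ∑ k, ∑ l, 2 * (conj (J.dg i k l) * J.dg' i k l).re / J.eig i)
      + ∑ i, ∑ k, J.eig k * (J.eig i)⁻¹ *
        (∑ l, normSq (J.dg i k l) + ∑ l, normSq (J.dg i l k) - J.ddg i k) := by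
  have hcomm : ∑ i, ∑ k, J.ddg' i k / J.eig i =
      ∑ k, ∑ i, J.ddg' k i / J.eig i + ∑ i, ∑ k, (J.ddg i k - J.ddg k i) / J.eig i := by
    rw [Finset.sum_comm (f := fun k i => J.ddg' k i / J.eig i)]
    simp only [← Finset.sum_add_distrib]
    refine Finset.sum_congr rfl fun i _ => Finset.sum_congr rfl fun k _ => ?_
    rw [← J.ddg_sub_ddg]
    ring
  have hlogdet : ∑ k, ∑ i, J.ddg' k i / J.eig i =
      ∑ k, J.ddF k + ∑ k, ∑ i, J.ddg k i - ∑ k, ∑ i, ∑ l, normSq (J.dg k i l)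
      + ∑ i, ∑ k, ∑ l, normSq (J.dg' k i l) / (J.eig i * J.eig l) := by
    rw [Finset.sum_comm (f := fun i k => ∑ l, normSq (J.dg' k i l) / (J.eig i * J.eig l))]
    simp only [← Finset.sum_add_distrib, ← Finset.sum_sub_distrib, ← J.ddlogdet_eq,
      sub_add_cancel]
  have hexpand : ∑ i, J.ddtr i / J.eig i = ∑ i, ∑ k, J.ddg' i k / J.eig i
      - ∑ i, ∑ k, ∑ l, 2 * (conj (J.dg i k l) * J.dg' i k l).re / J.eig i
      + ∑ i, ∑ k, J.eig k * (J.eig i)⁻¹ *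
        (∑ l, normSq (J.dg i k l) + ∑ l, normSq (J.dg i l k) - J.ddg i k) := by
    rw [← Finset.sum_sub_distrib, ← Finset.sum_add_distrib]
    refine Finset.sum_congr rfl fun i _ => ?_
    simp only [ddtr, add_div, sub_div, Finset.sum_div]
    congr 1
    exact Finset.sum_congr rfl fun k _ => by rw [div_eq_mul_inv]; ring
  rw [hexpand, hcomm, hlogdet]
  ring

lemma sum_ddg_ge (hB : J.BoundedBy B) :
    -((Fintype.card ι) ^ 2 * B) ≤ ∑ k, ∑ i, J.ddg k i :=
  calc _ = ∑ _k : ι, ∑ _i : ι, -B := by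
        simp only [Finset.sum_const, Finset.card_univ, nsmul_eq_mul]; ring
    _ ≤ _ := Finset.sum_le_sum fun k _ => Finset.sum_le_sum fun i _ => (abs_le.1 (hB.2 k i)).1

lemma sum_normSq_dg_le (hB : J.BoundedBy B) :
    ∑ k, ∑ i, ∑ l, normSq (J.dg k i l) ≤ (Fintype.card ι) ^ 3 * B ^ 2 :=
  calc _ ≤ ∑ _k : ι, ∑ _i : ι, ∑ _l : ι, B ^ 2 :=
        Finset.sum_le_sum fun k _ => Finset.sum_le_sum fun i _ => Finset.sum_le_sum fun l _ =>
          normSq_le_sq (hB.1 k i l)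
    _ = _ := by simp only [Finset.sum_const, Finset.card_univ, nsmul_eq_mul]; ring

lemma sum_ddg_sub_ddg_div_ge (hB : J.BoundedBy B) :
    -(2 * Fintype.card ι * B * J.trInv) ≤ ∑ i, ∑ k, (J.ddg i k - J.ddg k i) / J.eig i :=
  calc _ = ∑ i, ∑ _k : ι, -(2 * B) / J.eig i := by
        simp only [Finset.sum_const, Finset.card_univ, nsmul_eq_mul, div_eq_mul_inv,
          ← Finset.mul_sum, trInv]
        ring
    _ ≤ _ := Finset.sum_le_sum fun i _ => Finset.sum_le_sum fun k _ =>
        div_le_div_of_nonneg_right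
          (by linarith [(abs_le.1 (hB.2 i k)).1, (abs_le.1 (hB.2 k i)).2]) (J.eig_pos i).le

lemma sum_eig_mul_ge (hB : J.BoundedBy B) :
    -(B * J.tr * J.trInv) ≤ ∑ i, ∑ k, J.eig k * (J.eig i)⁻¹ *
      (∑ l, normSq (J.dg i k l) + ∑ l, normSq (J.dg i l k) - J.ddg i k) :=
  calc _ = ∑ i, ∑ k, J.eig k * (J.eig i)⁻¹ * (-B) := by
        simp only [← Finset.sum_mul, ← Finset.mul_sum, tr, trInv]
        ring
    _ ≤ _ := Finset.sum_le_sum fun i _ => Finset.sum_le_sum fun k _ => by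
        refine mul_le_mul_of_nonneg_left ?_ (mul_pos (J.eig_pos k) (inv_pos.2 (J.eig_pos i))).le
        have hrow : 0 ≤ ∑ l, normSq (J.dg i k l) := Finset.sum_nonneg fun _ _ => normSq_nonneg _
        have hcol : 0 ≤ ∑ l, normSq (J.dg i l k) := Finset.sum_nonneg fun _ _ => normSq_nonneg _
        linarith [(abs_le.1 (hB.2 i k)).2]

lemma sum_ddtr_div_eig_ge [Nonempty ι] (hB : J.BoundedBy B) (hF : -K ≤ ∑ k, J.ddF k) :
    (∑ i, normSq (J.dtr i) / J.eig i - 2 * ∑ i, (J.dtr i * conj (J.torsionTr i)).re / J.eig i)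
        / J.tr
      - (B + Fintype.card ι * B ^ 2) * J.tr * J.trInv
      - (2 * Fintype.card ι * B + 4 * (Fintype.card ι) ^ 2 * B ^ 2) * J.trInv
      - (K + (Fintype.card ι) ^ 2 * B + (Fintype.card ι) ^ 3 * B ^ 2)
      ≤ ∑ i, J.ddtr i / J.eig i := by
  rw [sum_ddtr_div_eig]
  linarith [normSq_dtr_div_tr_le (J := J), third_order_ge hB, sum_ddg_ge hB, sum_normSq_dg_le hB,
    sum_ddg_sub_ddg_div_ge hB, sum_eig_mul_ge hB]

/-- The constant in the lower bound for the Laplacian of `log tr_g g'`. -/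
def laplacianConst (n : ℕ) (B K : ℝ) : ℝ :=
  (B + n * B ^ 2) + (2 * n * B + 4 * n ^ 2 * B ^ 2) * Real.exp K +
    (K + n ^ 2 * B + n ^ 3 * B ^ 2) * Real.exp K ^ 2

lemma laplacianConst_nonneg (n : ℕ) (hB : 0 ≤ B) (hK : 0 ≤ K) : 0 ≤ laplacianConst n B K := by
  unfold laplacianConst
  positivity

lemma exp_neg_le_tr [Nonempty ι] (hF : |J.F| ≤ K) : Real.exp (-K) ≤ J.tr := by
  refine le_sum_of_le_prod J.eig_pos ?_ ?_
  · exact Real.exp_le_one_iff.2 (neg_nonpos.2 ((abs_nonneg _).trans hF))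
  · rw [J.prod_eig]
    exact Real.exp_le_exp.2 (abs_le.1 hF).1

lemma exp_neg_le_trInv [Nonempty ι] (hF : |J.F| ≤ K) : Real.exp (-K) ≤ J.trInv := by
  refine le_sum_of_le_prod (fun i => inv_pos.2 (J.eig_pos i)) ?_ ?_
  · exact Real.exp_le_one_iff.2 (neg_nonpos.2 ((abs_nonneg _).trans hF))
  · rw [Finset.prod_inv_distrib, J.prod_eig, ← Real.exp_neg]
    exact Real.exp_le_exp.2 (neg_le_neg (abs_le.1 hF).2)

lemma one_le_exp_mul_trInv [Nonempty ι] (hF : |J.F| ≤ K) : 1 ≤ Real.exp K * J.trInv :=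
  calc (1 : ℝ) = Real.exp K * Real.exp (-K) := by
        rw [← Real.exp_add, add_neg_cancel, Real.exp_zero]
    _ ≤ _ := mul_le_mul_of_nonneg_left (exp_neg_le_trInv hF) (Real.exp_pos K).le

/-- The left-hand side is the Laplacian of `log tr_g g'` with respect to `g'`. -/
lemma laplacian_log_tr_ge [Nonempty ι] (hB0 : 0 ≤ B) (hB : J.BoundedBy B) (hFK : |J.F| ≤ K)
    (hF : -K ≤ ∑ k, J.ddF k) :
    -(2 * ∑ i, (J.dtr i * conj (J.torsionTr i)).re / J.eig i) / J.tr ^ 2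
      - laplacianConst (Fintype.card ι) B K * J.trInv ≤
      (∑ i, J.ddtr i / J.eig i) / J.tr - (∑ i, normSq (J.dtr i) / J.eig i) / J.tr ^ 2 := by
  have hK : 0 ≤ K := (abs_nonneg _).trans hFK
  have htr : 0 < J.tr := (Real.exp_pos _).trans_le (exp_neg_le_tr hFK)
  have htrInv : 0 < J.trInv := (Real.exp_pos _).trans_le (exp_neg_le_trInv hFK)
  have inv_le : J.tr⁻¹ ≤ Real.exp K := by
    rw [← neg_neg K, Real.exp_neg (-K)]
    exact inv_anti₀ (Real.exp_pos _) (exp_neg_le_tr hFK)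
  set c₁ := 2 * Fintype.card ι * B + 4 * (Fintype.card ι : ℝ) ^ 2 * B ^ 2
  set c₂ := K + (Fintype.card ι : ℝ) ^ 2 * B + (Fintype.card ι : ℝ) ^ 3 * B ^ 2
  have hc₁ : c₁ * J.trInv * J.tr⁻¹ ≤ c₁ * J.trInv * Real.exp K := by gcongr
  have hc₂ : c₂ * J.tr⁻¹ ≤ c₂ * (Real.exp K * (Real.exp K * J.trInv)) := by
    gcongr
    exact inv_le.trans (le_mul_of_one_le_right (Real.exp_pos K).le (one_le_exp_mul_trInv hFK))
  have hdiv := div_le_div_of_nonneg_right (sum_ddtr_div_eig_ge hB hF) htr.le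
  set P := ∑ i, normSq (J.dtr i) / J.eig i
  set T := ∑ i, (J.dtr i * conj (J.torsionTr i)).re / J.eig i
  have expand : ((P - 2 * T) / J.tr - (B + Fintype.card ι * B ^ 2) * J.tr * J.trInv
      - c₁ * J.trInv - c₂) / J.tr =
      P / J.tr ^ 2 + -(2 * T) / J.tr ^ 2 - (B + Fintype.card ι * B ^ 2) * J.trInv
      - c₁ * J.trInv * J.tr⁻¹ - c₂ * J.tr⁻¹ := by
    field_simp
    ring
  rw [expand] at hdiv
  have hconst : laplacianConst (Fintype.card ι) B K * J.trInv =
      (B + Fintype.card ι * B ^ 2) * J.trInv + c₁ * J.trInv * Real.exp K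
      + c₂ * (Real.exp K * (Real.exp K * J.trInv)) := by
    unfold laplacianConst
    ring
  linarith

/-- AM–GM, using that the gradient of `tr_g g'` is a multiple of that of `φ`. -/
lemma torsion_term_le {a b : ℝ} (ha : 0 ≤ a) (hb : 0 < b) (htr : 0 < J.tr)
    (hB : J.BoundedBy B) {dφ : ι → ℂ} (hcrit : ∀ i, J.dtr i / (J.tr : ℂ) = a * dφ i)
    (hlarge : (a * (2 * Fintype.card ι * B)) ^ 2 ≤ b * J.tr ^ 2) (i : ι) :
    2 * (J.dtr i * conj (J.torsionTr i)).re / J.tr ^ 2 ≤ b * normSq (dφ i) + 1 := by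
  set β := a * (2 * Fintype.card ι * B)
  have hre : (J.dtr i * conj (J.torsionTr i)).re / J.tr ≤ ‖dφ i‖ * β :=
    calc (J.dtr i * conj (J.torsionTr i)).re / J.tr
        = (conj (J.torsionTr i) * (J.dtr i / (J.tr : ℂ))).re := by
          rw [← Complex.div_ofReal_re]
          congr 1
          ring
      _ = (conj (J.torsionTr i) * (a * dφ i)).re := by rw [hcrit i]
      _ ≤ (2 * Fintype.card ι * B) * (a * ‖dφ i‖) :=
          re_conj_mul_le (norm_torsionTr_le hB i) (by
            rw [norm_mul, Complex.norm_real, Real.norm_of_nonneg ha])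
      _ = ‖dφ i‖ * β := by ring
  have hβ : β ^ 2 / (b * J.tr ^ 2) ≤ 1 := (div_le_one (by positivity)).2 hlarge
  have hsquare : b * normSq (dφ i) + β ^ 2 / (b * J.tr ^ 2) - 2 / J.tr * (‖dφ i‖ * β)
      = b * (‖dφ i‖ - β / (b * J.tr)) ^ 2 := by
    rw [normSq_eq_norm_sq]
    field_simp
    ring
  have hnonneg : 0 ≤ b * (‖dφ i‖ - β / (b * J.tr)) ^ 2 := by positivity
  calc 2 * (J.dtr i * conj (J.torsionTr i)).re / J.tr ^ 2
      = 2 / J.tr * ((J.dtr i * conj (J.torsionTr i)).re / J.tr) := by field_simp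
    _ ≤ 2 / J.tr * (‖dφ i‖ * β) := mul_le_mul_of_nonneg_left hre (by positivity)
    _ ≤ b * normSq (dφ i) + 1 := by linarith

/-- The maximum principle for `log tr_g g' + η(φ)`, where `η' = -a` and `η'' = b` at the maximum:
`hcrit` is the vanishing of the first derivatives and `hmax` the sign of the second ones. -/
lemma tr_le_of_max [Nonempty ι] (hB0 : 0 ≤ B) (hB : J.BoundedBy B) (hFK : |J.F| ≤ K)
    (hF : -K ≤ ∑ k, J.ddF k) {a b : ℝ} (ha : laplacianConst (Fintype.card ι) B K + 2 ≤ a)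
    (hb : 0 < b) {dφ : ι → ℂ} (hcrit : ∀ i, J.dtr i / (J.tr : ℂ) = a * dφ i)
    (hmax : ∀ i, J.ddtr i / J.tr - normSq (J.dtr i) / J.tr ^ 2
      - a * (J.eig i - 1) + b * normSq (dφ i) ≤ 0) :
    b * J.tr ^ 2 ≤ (a * (2 * Fintype.card ι * B)) ^ 2 ∨
      J.tr ≤ Fintype.card ι * (Real.exp K * (1 + a * Fintype.card ι) ^ Fintype.card ι) := by
  refine or_iff_not_imp_left.2 fun hlarge => sum_le_of_sum_inv_le J.eig_pos ?_ ?_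
  · rw [J.prod_eig]
    exact Real.exp_le_exp.2 (abs_le.1 hFK).2
  have hconst : 0 ≤ laplacianConst (Fintype.card ι) B K :=
    laplacianConst_nonneg _ hB0 ((abs_nonneg _).trans hFK)
  have ha0 : 0 ≤ a := by linarith
  have htr : 0 < J.tr := (Real.exp_pos _).trans_le (exp_neg_le_tr hFK)
  have hterm : ∀ i, (J.ddtr i / J.eig i) / J.tr - (normSq (J.dtr i) / J.eig i) / J.tr ^ 2
      + 2 * ((J.dtr i * conj (J.torsionTr i)).re / J.eig i) / J.tr ^ 2
      ≤ a * (1 - (J.eig i)⁻¹) + (J.eig i)⁻¹ := fun i => by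
    have hi := J.eig_pos i
    have h := add_le_add (hmax i) (torsion_term_le ha0 hb htr hB hcrit (not_le.1 hlarge).le i)
    have h' : J.ddtr i / J.tr - normSq (J.dtr i) / J.tr ^ 2
        + 2 * (J.dtr i * conj (J.torsionTr i)).re / J.tr ^ 2 ≤ a * (J.eig i - 1) + 1 := by
      linarith
    calc _ = (J.ddtr i / J.tr - normSq (J.dtr i) / J.tr ^ 2
          + 2 * (J.dtr i * conj (J.torsionTr i)).re / J.tr ^ 2) / J.eig i := by ring
      _ ≤ (a * (J.eig i - 1) + 1) / J.eig i := div_le_div_of_nonneg_right h' hi.le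
      _ = _ := by field_simp
  have hsum := Finset.sum_le_sum fun i (_ : i ∈ Finset.univ) => hterm i
  simp only [Finset.sum_add_distrib, Finset.sum_sub_distrib, ← Finset.sum_div, ← Finset.mul_sum,
    Finset.sum_const, Finset.card_univ, nsmul_eq_mul, mul_one] at hsum
  have hlap := laplacian_log_tr_ge hB0 hB hFK hF
  rw [neg_div] at hlap
  have htrInv : 0 < J.trInv := (Real.exp_pos _).trans_le (exp_neg_le_trInv hFK)
  have hcoef : 1 * J.trInv ≤ (a - laplacianConst (Fintype.card ι) B K - 1) * J.trInv :=
    mul_le_mul_of_nonneg_right (by linarith) htrInv.le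
  change J.trInv ≤ _
  unfold trInv at *
  linarith

end MongeAmpereJet

/-! ### Top wedge powers of (1,1)-forms -/

section WedgePowers

lemma sum_eq_sum_perm {ι R : Type*} [Fintype ι] [DecidableEq ι] [AddCommMonoid R]
    {c : (ι → ι) → R} (hc : ∀ f, ¬ Injective f → c f = 0) :
    ∑ f, c f = ∑ σ : Equiv.Perm ι, c σ := by
  refine (Fintype.sum_of_injective (fun σ : Equiv.Perm ι => (σ : ι → ι)) DFunLike.coe_injective
    _ _ (fun f hf => hc f fun hinj => hf ?_) fun _ => rfl).symm
  exact ⟨Equiv.ofBijective f (Finite.injective_iff_bijective.1 hinj), rfl⟩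

lemma det_submatrix_sumMap_eq_zero {ι R : Type*} [Fintype ι] [DecidableEq ι] [CommRing R]
    (T : Matrix (ι ⊕ ι) (ι ⊕ ι) R) {f g : ι → ι} (h : ¬ (Injective f ∧ Injective g)) :
    (T.submatrix (Sum.map f g) id).det = 0 := by
  rw [← Sum.map_injective] at h
  obtain ⟨a, b, hab, hne⟩ : ∃ a b, Sum.map f g a = Sum.map f g b ∧ a ≠ b := by
    simpa only [Injective, not_forall, exists_prop] using h
  refine Matrix.det_zero_of_row_eq hne ?_
  ext c
  rw [Matrix.submatrix_apply, Matrix.submatrix_apply, hab]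

lemma sum_prod_mul_det_submatrix_sumMap {ι R : Type*} [Fintype ι] [DecidableEq ι] [CommRing R]
    (H : Matrix ι ι R) (T : Matrix (ι ⊕ ι) (ι ⊕ ι) R) :
    ∑ f : ι → ι, ∑ g : ι → ι, (∏ a, H (f a) (g a)) * (T.submatrix (Sum.map f g) id).det =
      (Fintype.card ι).factorial * H.det * T.det := by
  have hperm : ∀ σ τ : Equiv.Perm ι, (T.submatrix (Sum.map σ τ) id).det =
      (σ.sign : R) * (τ.sign : R) * T.det := fun σ τ => by
    have h := Matrix.det_permute (Equiv.Perm.sumCongr σ τ) T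
    rw [Equiv.Perm.sign_sumCongr] at h
    push_cast at h
    exact h
  have hcolumn : ∀ τ : Equiv.Perm ι,
      ∑ f : ι → ι, (∏ a, H (f a) (τ a)) * (T.submatrix (Sum.map f τ) id).det = H.det * T.det :=
    fun τ => by
    have hsign : (τ.sign : R) * (τ.sign : R) = 1 := by
      rw [← Int.cast_mul, Int.units_coe_mul_self, Int.cast_one]
    rw [sum_eq_sum_perm fun f hf => by
      rw [det_submatrix_sumMap_eq_zero T fun h => hf h.1, mul_zero]]
    calc _ = (τ.sign : R) * (H.submatrix id τ).det * T.det := by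
          rw [Matrix.det_apply' (H.submatrix id τ), Finset.mul_sum, Finset.sum_mul]
          refine Finset.sum_congr rfl fun σ _ => ?_
          simp only [hperm, Matrix.submatrix_apply, id]
          ring
      _ = H.det * T.det := by rw [Matrix.det_permute', ← mul_assoc, hsign, one_mul]
  rw [Finset.sum_comm, sum_eq_sum_perm fun g hg => Finset.sum_eq_zero fun f _ => by
    rw [det_submatrix_sumMap_eq_zero T fun h => hg h.2, mul_zero]]
  simp only [hcolumn, Finset.sum_const, Finset.card_univ, Fintype.card_perm, nsmul_eq_mul,
    mul_assoc]

variable {n k p q : ℕ}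

lemma wedge_apply (α : CForm n p) (β : CForm n q) (v : Fin (p + q) → Cn n) :
    wedge α β v = (p.factorial * q.factorial : ℂ)⁻¹ * ∑ σ : Equiv.Perm (Fin (p + q)),
      (σ.sign : ℂ) *
        (α (fun i => v (σ (Fin.castAdd q i))) * β (fun j => v (σ (Fin.natAdd p j)))) := by
  rw [wedge, ContinuousAlternatingMap.smul_apply,
    ContinuousMultilinearMap.alternatization_apply_apply, real_smul]
  push_cast
  congr 1
  refine Finset.sum_congr rfl fun σ _ => ?_
  rw [Units.smul_def, zsmul_eq_mul]
  rfl

/-- The decomposable form `ξ₀ ∧ ⋯ ∧ ξₖ₋₁`. The covectors `ξᵢ` are arbitrary functions, since only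
their values enter. -/
def wedgeCovec (ξ : Fin k → Cn n → ℂ) (v : Fin k → Cn n) : ℂ :=
  Matrix.det (Matrix.of fun a b => ξ a (v b))

lemma wedgeCovec_eq_sum (ξ : Fin k → Cn n → ℂ) (v : Fin k → Cn n) :
    wedgeCovec ξ v = ∑ σ : Equiv.Perm (Fin k), (σ.sign : ℂ) * ∏ a, ξ a (v (σ a)) := by
  rw [wedgeCovec, ← Matrix.det_transpose, Matrix.det_apply']
  rfl

lemma sum_perm_mul_prod_mul_prod (ξ : Fin p → Cn n → ℂ) (η : Fin q → Cn n → ℂ)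
    (v : Fin (p + q) → Cn n) (τ : Equiv.Perm (Fin p)) (ρ : Equiv.Perm (Fin q)) :
    ∑ σ : Equiv.Perm (Fin (p + q)), (σ.sign : ℂ) *
      (((τ.sign : ℂ) * ∏ a, ξ a (v (σ (Fin.castAdd q (τ a))))) *
        ((ρ.sign : ℂ) * ∏ a, η a (v (σ (Fin.natAdd p (ρ a)))))) =
      wedgeCovec (Fin.append ξ η) v := by
  set κ : Equiv.Perm (Fin (p + q)) := finSumFinEquiv.permCongr (Equiv.Perm.sumCongr τ ρ) with hκ
  have hsign : κ.sign = τ.sign * ρ.sign := by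
    rw [hκ, Equiv.Perm.sign_permCongr, Equiv.Perm.sign_sumCongr]
  have hleft : ∀ a, κ (Fin.castAdd q a) = Fin.castAdd q (τ a) := fun a => by
    simp [hκ, Equiv.permCongr_apply]
  have hright : ∀ a, κ (Fin.natAdd p a) = Fin.natAdd p (ρ a) := fun a => by
    simp [hκ, Equiv.permCongr_apply]
  rw [wedgeCovec_eq_sum, ← Equiv.sum_comp (Equiv.mulRight κ) fun σ =>
    (σ.sign : ℂ) * ∏ a, Fin.append ξ η a (v (σ a))]
  refine Finset.sum_congr rfl fun σ _ => ?_
  simp only [Equiv.coe_mulRight, Equiv.Perm.sign_mul, hsign, Fin.prod_univ_add, Fin.append_left,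
    Fin.append_right, Equiv.Perm.mul_apply, hleft, hright]
  push_cast
  ring

lemma sum_perm_wedgeCovec_mul (ξ : Fin p → Cn n → ℂ) (η : Fin q → Cn n → ℂ)
    (v : Fin (p + q) → Cn n) :
    ∑ σ : Equiv.Perm (Fin (p + q)), (σ.sign : ℂ) *
      (wedgeCovec ξ (fun i => v (σ (Fin.castAdd q i))) *
        wedgeCovec η (fun j => v (σ (Fin.natAdd p j)))) =
      (p.factorial * q.factorial : ℂ) * wedgeCovec (Fin.append ξ η) v := by
  calc _ = ∑ σ : Equiv.Perm (Fin (p + q)), ∑ τ : Equiv.Perm (Fin p), ∑ ρ : Equiv.Perm (Fin q),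
        (σ.sign : ℂ) * (((τ.sign : ℂ) * ∏ a, ξ a (v (σ (Fin.castAdd q (τ a))))) *
          ((ρ.sign : ℂ) * ∏ a, η a (v (σ (Fin.natAdd p (ρ a)))))) := by
        simp only [wedgeCovec_eq_sum, ← Finset.mul_sum, ← Finset.sum_mul]
    _ = ∑ _τ : Equiv.Perm (Fin p), ∑ _ρ : Equiv.Perm (Fin q), wedgeCovec (Fin.append ξ η) v := by
        rw [Finset.sum_comm]
        refine Finset.sum_congr rfl fun τ _ => ?_
        rw [Finset.sum_comm]
        exact Finset.sum_congr rfl fun ρ _ => sum_perm_mul_prod_mul_prod ξ η v τ ρ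
    _ = _ := by simp [Fintype.card_perm, mul_assoc]

lemma wedge_apply_of_eq_sum_wedgeCovec {κ μ : Type*} [Fintype κ] [Fintype μ] {α : CForm n p}
    {β : CForm n q} {c : κ → ℂ} {d : μ → ℂ} {ξ : κ → Fin p → Cn n → ℂ} {η : μ → Fin q → Cn n → ℂ}
    (hα : ∀ v, α v = ∑ x, c x * wedgeCovec (ξ x) v)
    (hβ : ∀ v, β v = ∑ y, d y * wedgeCovec (η y) v) (v : Fin (p + q) → Cn n) :
    wedge α β v = ∑ x, ∑ y, c x * d y * wedgeCovec (Fin.append (ξ x) (η y)) v := by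
  have hne : (p.factorial * q.factorial : ℂ) ≠ 0 := by
    exact_mod_cast (mul_pos p.factorial_pos q.factorial_pos).ne'
  rw [wedge_apply, inv_mul_eq_iff_eq_mul₀ hne]
  calc _ = ∑ σ : Equiv.Perm (Fin (p + q)), ∑ x, ∑ y, c x * d y * ((σ.sign : ℂ) *
        (wedgeCovec (ξ x) (fun i => v (σ (Fin.castAdd q i))) *
          wedgeCovec (η y) (fun j => v (σ (Fin.natAdd p j))))) := by
        refine Finset.sum_congr rfl fun σ _ => ?_
        rw [hα, hβ, Finset.sum_mul_sum, Finset.mul_sum]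
        refine Finset.sum_congr rfl fun x _ => ?_
        rw [Finset.mul_sum]
        exact Finset.sum_congr rfl fun y _ => by ring
    _ = ∑ x, ∑ y, c x * d y * ((p.factorial * q.factorial : ℂ) *
          wedgeCovec (Fin.append (ξ x) (η y)) v) := by
        simp only [← sum_perm_wedgeCovec_mul, Finset.mul_sum (s := (Finset.univ :
          Finset (Equiv.Perm (Fin (p + q)))))]
        rw [Finset.sum_comm]
        exact Finset.sum_congr rfl fun x _ => Finset.sum_comm
    _ = _ := by simp only [Finset.mul_sum, mul_left_comm]

/-- The covectors `dzⁱ` (left summand) and `dz̄ⁱ` (right summand). -/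
def covec : Fin n ⊕ Fin n → Cn n → ℂ :=
  Sum.elim (fun i v => v i) (fun i v => conj (v i))

lemma wedge_dz_dzbar_apply (i j : Fin n) (v : Fin 2 → Cn n) :
    wedge (dz i) (dzbar j) v = wedgeCovec ![covec (Sum.inl i), covec (Sum.inr j)] v := by
  have happend : Fin.append ![covec (Sum.inl i)] ![covec (Sum.inr j)] =
      ![covec (Sum.inl i), covec (Sum.inr j)] := by
    ext a
    fin_cases a <;> rfl
  rw [wedge_apply_of_eq_sum_wedgeCovec (c := fun _ : Unit => 1) (d := fun _ : Unit => 1)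
    (ξ := fun _ => ![covec (Sum.inl i)]) (η := fun _ => ![covec (Sum.inr j)])
    (fun w => by simp [wedgeCovec, dz, covec]) (fun w => by simp [wedgeCovec, dzbar, covec])]
  simp [happend]

lemma formOfMatrix_apply (H : Matrix (Fin n) (Fin n) ℂ) (v : Fin 2 → Cn n) :
    formOfMatrix H v = ∑ s : Fin n × Fin n,
      I * H s.1 s.2 * wedgeCovec ![covec (Sum.inl s.1), covec (Sum.inr s.2)] v := by
  simp only [formOfMatrix, ContinuousAlternatingMap.smul_apply, ContinuousAlternatingMap.sum_apply,
    wedge_dz_dzbar_apply, smul_eq_mul, Finset.mul_sum, mul_assoc, Fintype.sum_prod_type]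

/-- The bijection `j ↦ 2 j` on the left summand, `j ↦ 2 j + 1` on the right one. -/
def interleaveEquiv (k : ℕ) : Fin k ⊕ Fin k ≃ Fin (2 * k) where
  toFun := Sum.elim (fun j => ⟨2 * j, by omega⟩) (fun j => ⟨2 * j + 1, by omega⟩)
  invFun a := if (a : ℕ) % 2 = 0 then Sum.inl ⟨a / 2, by omega⟩ else Sum.inr ⟨a / 2, by omega⟩
  left_inv := by
    rintro (j | j)
    · simp
    · simp [Nat.add_mod, show (2 * (j : ℕ) + 1) / 2 = j by omega]
  right_inv a := by
    by_cases h : (a : ℕ) % 2 = 0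
    · simp only [h, if_true, Sum.elim_inl]
      exact Fin.ext (by dsimp only; omega)
    · simp only [h, if_false, Sum.elim_inr]
      exact Fin.ext (by dsimp only; omega)

/-- The sequence `x₀, y₀, x₁, y₁, …`. -/
def interleave {α : Type*} (x y : Fin k → α) : Fin (2 * k) → α :=
  Sum.elim x y ∘ (interleaveEquiv k).symm

lemma interleave_snoc {α : Type*} (x y : Fin k → α) (a b : α) :
    interleave (Fin.snoc (α := fun _ => α) x a) (Fin.snoc (α := fun _ => α) y b) =
      Fin.append (interleave x y) ![a, b] := by
  ext1 c
  refine Fin.addCases (m := 2 * k) (n := 2) (fun d => ?_) (fun d => ?_) c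
  · have hd : (d : ℕ) / 2 < k := by omega
    rw [Fin.append_left]
    by_cases h : (d : ℕ) % 2 = 0 <;> simp [interleave, interleaveEquiv, Fin.snoc, hd, h]
  · rw [Fin.append_right]
    fin_cases d
    · simp [interleave, interleaveEquiv, Fin.snoc]
    · simp [interleave, interleaveEquiv, Fin.snoc, Nat.add_mod, show (2 * k + 1) / 2 = k by omega]

lemma wedgePow_formOfMatrix_apply (H : Matrix (Fin n) (Fin n) ℂ) (k : ℕ)
    (v : Fin (2 * k) → Cn n) :
    wedgePow (formOfMatrix H) k v = ∑ f : Fin k → Fin n × Fin n,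
      (∏ a, I * H (f a).1 (f a).2) *
        wedgeCovec (interleave (fun a => covec (Sum.inl (f a).1))
          fun a => covec (Sum.inr (f a).2)) v := by
  induction k with
  | zero => simp [wedgePow, wedgeCovec]
  | succ k ih =>
    change wedge (wedgePow (formOfMatrix H) k) (formOfMatrix H) v = _
    rw [wedge_apply_of_eq_sum_wedgeCovec ih (formOfMatrix_apply H),
      ← (Fin.snocEquiv fun _ => Fin n × Fin n).sum_comp, Fintype.sum_prod_type, Finset.sum_comm]
    refine Finset.sum_congr rfl fun s _ => Finset.sum_congr rfl fun f _ => ?_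
    rw [← interleave_snoc]
    have hsnoc : ∀ G : Fin n × Fin n → Cn n → ℂ,
        Fin.snoc (α := fun _ => Cn n → ℂ) (fun a => G (f a)) (G s) =
          fun a => G (Fin.snoc (α := fun _ => Fin n × Fin n) f s a) := fun G =>
      (Fin.comp_snoc G f s).symm
    rw [hsnoc fun t => covec (Sum.inl t.1), hsnoc fun t => covec (Sum.inr t.2)]
    simp [Fin.prod_univ_castSucc]

/-- The real frame `e₁, √-1 e₁, e₂, √-1 e₂, …` of `ℂⁿ`. -/
def stdFrame (n : ℕ) : Fin (2 * n) → Cn n :=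
  interleave (fun j => Pi.single j 1) fun j => Pi.single j I

/-- The matrix of the covectors `dzⁱ`, `dz̄ⁱ` in the frame `stdFrame`. -/
def covecMatrix (n : ℕ) : Matrix (Fin n ⊕ Fin n) (Fin n ⊕ Fin n) ℂ :=
  Matrix.fromBlocks 1 (I • 1) 1 (-I • 1)

lemma det_covecMatrix_ne_zero : (covecMatrix n).det ≠ 0 := by
  have h : (-I • 1 - 1 * I • 1 : Matrix (Fin n) (Fin n) ℂ) = (-2 * I) • 1 := by
    rw [one_mul, ← sub_smul]
    congr 1
    ring
  rw [covecMatrix, Matrix.det_fromBlocks_one₁₁, h, Matrix.det_smul, Matrix.det_one]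
  simp

lemma wedgeCovec_interleave_stdFrame (f g : Fin n → Fin n) :
    wedgeCovec (interleave (fun a => covec (Sum.inl (f a))) fun a => covec (Sum.inr (g a)))
        (stdFrame n) =
      ((covecMatrix n).submatrix (Sum.map f g) id).det := by
  rw [wedgeCovec, ← Matrix.det_submatrix_equiv_self (interleaveEquiv n)]
  congr 1
  ext a b
  rcases a with a | a <;> rcases b with b | b <;>
    simp [stdFrame, interleave, covecMatrix, covec, Pi.single_apply, Matrix.one_apply,
      apply_ite (conj : ℂ → ℂ), apply_ite (Neg.neg : ℂ → ℂ)]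

lemma wedgePow_formOfMatrix_stdFrame (H : Matrix (Fin n) (Fin n) ℂ) :
    wedgePow (formOfMatrix H) n (stdFrame n) =
      n.factorial * I ^ n * (covecMatrix n).det * H.det := by
  rw [wedgePow_formOfMatrix_apply,
    ← (Equiv.arrowProdEquivProdArrow (Fin n) (fun _ => Fin n) fun _ => Fin n).symm.sum_comp,
    Fintype.sum_prod_type]
  have h := sum_prod_mul_det_submatrix_sumMap (I • H) (covecMatrix n)
  rw [Matrix.det_smul, Fintype.card_fin] at h
  rw [mul_right_comm, mul_assoc _ (I ^ n), ← h]
  exact Finset.sum_congr rfl fun f _ => Finset.sum_congr rfl fun g _ =>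
    congrArg _ (wedgeCovec_interleave_stdFrame f g)

lemma det_eq_of_wedgePow_eq {H G : Matrix (Fin n) (Fin n) ℂ} {c : ℂ}
    (h : wedgePow (formOfMatrix H) n = c • wedgePow (formOfMatrix G) n) :
    H.det = c * G.det := by
  have heval := congrArg (fun α : CForm n (2 * n) => α (stdFrame n)) h
  simp only [ContinuousAlternatingMap.smul_apply, wedgePow_formOfMatrix_stdFrame,
    smul_eq_mul] at heval
  have hne : n.factorial * I ^ n * (covecMatrix n).det ≠ 0 := by
    simp [Nat.factorial_ne_zero, det_covecMatrix_ne_zero]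
  refine mul_left_cancel₀ hne ?_
  rw [heval]
  ring

end WedgePowers

/-! ### Wirtinger derivatives along vectors -/

/-- The derivative `½ (∂_v f + s ∂_{√-1 v} f)`. The two Wirtinger derivatives along `v` are the
cases `s = -√-1`, denoted `∂[v] f`, and `s = √-1`, denoted `∂̄[v] f`. -/
def wirt {E 𝔸 : Type*} [NormedAddCommGroup E] [NormedSpace ℂ E] [NormedAddCommGroup 𝔸]
    [NormedSpace ℂ 𝔸] (s : ℂ) (v : E) (f : E → 𝔸) (z : E) : 𝔸 :=
  (1 / 2 : ℂ) • (fderiv ℝ f z v + s • fderiv ℝ f z (I • v))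

local notation "∂[" v "]" => wirt (-I) v
local notation "∂̄[" v "]" => wirt I v

section Wirtinger

variable {E 𝔸 𝔹 : Type*} [NormedAddCommGroup E] [NormedSpace ℂ E]
  [NormedAddCommGroup 𝔸] [NormedSpace ℂ 𝔸] [NormedAddCommGroup 𝔹] [NormedSpace ℂ 𝔹]

theorem fderiv_smul_complex (f : E → 𝔸) (z v : E) (c : ℂ) :
    fderiv ℝ f z (c • v) = (c.re : ℂ) • fderiv ℝ f z v + (c.im : ℂ) • fderiv ℝ f z (I • v) := by
  have hc : c • v = c.re • v + c.im • I • v := by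
    conv_lhs => rw [← re_add_im c]
    rw [add_smul, mul_smul, coe_smul, coe_smul]
  rw [hc, map_add, map_smul, map_smul, coe_smul, coe_smul]

theorem del_smul (c : ℂ) (v : E) (f : E → 𝔸) (z : E) : ∂[c • v] f z = c • ∂[v] f z := by
  rw [wirt, wirt, smul_smul, fderiv_smul_complex f z v c, fderiv_smul_complex f z v (I * c)]
  conv_rhs => rw [← re_add_im c]
  simp only [mul_re, I_re, zero_mul, I_im, one_mul, zero_sub, mul_im, zero_add, ofReal_neg]
  match_scalars
  · ring
  · linear_combination (1 / 2 * c.im : ℂ) * I_sq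

theorem delbar_smul (c : ℂ) (v : E) (f : E → 𝔸) (z : E) : ∂̄[c • v] f z = conj c • ∂̄[v] f z := by
  rw [wirt, wirt, smul_smul, fderiv_smul_complex f z v c, fderiv_smul_complex f z v (I * c)]
  rw [show conj c = c.re - c.im * I by apply Complex.ext <;> simp]
  simp only [mul_re, I_re, zero_mul, I_im, one_mul, zero_sub, mul_im, zero_add, ofReal_neg]
  match_scalars
  · ring
  · linear_combination (1 / 2 * c.im : ℂ) * I_sq

theorem wirt_vec_sum {ι : Type*} (t : Finset ι) (s : ℂ) (v : ι → E) (f : E → 𝔸) (z : E) :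
    wirt s (∑ a ∈ t, v a) f z = ∑ a ∈ t, wirt s (v a) f z := by
  simp only [wirt, Finset.smul_sum, map_sum, ← Finset.sum_add_distrib]

theorem del_sum_smul {ι : Type*} [Fintype ι] (c : ι → ℂ) (v : ι → E) (f : E → 𝔸) (z : E) :
    ∂[∑ a, c a • v a] f z = ∑ a, c a • ∂[v a] f z := by
  simp only [wirt_vec_sum, del_smul]

theorem delbar_sum_smul {ι : Type*} [Fintype ι] (c : ι → ℂ) (v : ι → E) (f : E → 𝔸) (z : E) :
    ∂̄[∑ a, c a • v a] f z = ∑ a, conj (c a) • ∂̄[v a] f z := by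
  simp only [wirt_vec_sum, delbar_smul]

variable {s : ℂ} {v : E} {f g : E → 𝔸} {z : E} {U : Set E}

theorem wirt_congr (hU : IsOpen U) (hz : z ∈ U) (h : EqOn f g U) :
    wirt s v f z = wirt s v g z := by
  rw [wirt, wirt, (h.eventuallyEq_of_mem (hU.mem_nhds hz)).fderiv_eq]

theorem wirt_add (hf : DifferentiableAt ℝ f z) (hg : DifferentiableAt ℝ g z) :
    wirt s v (fun w => f w + g w) z = wirt s v f z + wirt s v g z := by
  simp only [wirt, fderiv_fun_add hf hg, add_apply]
  module

theorem wirt_sub (hf : DifferentiableAt ℝ f z) (hg : DifferentiableAt ℝ g z) :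
    wirt s v (fun w => f w - g w) z = wirt s v f z - wirt s v g z := by
  simp only [wirt, fderiv_fun_sub hf hg, sub_apply]
  module

theorem wirt_comp {G : 𝔸 → 𝔹} {L : 𝔸 →L[ℂ] 𝔹} (hG : HasFDerivAt G L (f z))
    (hf : DifferentiableAt ℝ f z) : wirt s v (fun w => G (f w)) z = L (wirt s v f z) := by
  have h : fderiv ℝ (fun w => G (f w)) z = (L.restrictScalars ℝ).comp (fderiv ℝ f z) :=
    ((hG.restrictScalars ℝ).comp z hf.hasFDerivAt).fderiv
  simp [wirt, h]

theorem wirt_clm_comp (L : 𝔸 →L[ℂ] 𝔹) (hf : DifferentiableAt ℝ f z) :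
    wirt s v (fun w => L (f w)) z = L (wirt s v f z) :=
  wirt_comp L.hasFDerivAt hf

theorem wirt_sum_smul {ι : Type*} [Fintype ι] (c : ι → ℂ) {f : ι → E → 𝔸}
    (hf : ∀ a, DifferentiableAt ℝ (f a) z) :
    wirt s v (fun w => ∑ a, c a • f a w) z = ∑ a, c a • wirt s v (f a) z := by
  have h : fderiv ℝ (fun w => ∑ a, c a • f a w) z = ∑ a, c a • fderiv ℝ (f a) z :=
    (HasFDerivAt.fun_sum fun a _ => (hf a).hasFDerivAt.const_smul (c a)).fderiv
  simp only [wirt, h, sum_apply, smul_apply, Finset.smul_sum, ← Finset.sum_add_distrib]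
  exact Finset.sum_congr rfl fun a _ => by module

theorem wirt_mul {𝔸 : Type*} [NormedRing 𝔸] [NormedAlgebra ℂ 𝔸] {f g : E → 𝔸}
    (hf : DifferentiableAt ℝ f z) (hg : DifferentiableAt ℝ g z) :
    wirt s v (fun w => f w * g w) z = wirt s v f z * g z + f z * wirt s v g z := by
  simp only [wirt, fderiv_fun_mul' hf hg, add_apply, smul_apply, smul_eq_mul,
    MulOpposite.smul_eq_mul_unop, MulOpposite.unop_op, smul_add, add_mul, mul_add, smul_mul_assoc,
    mul_smul_comm]
  abel

theorem wirt_exp {f : E → ℂ} (hf : DifferentiableAt ℝ f z) :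
    wirt s v (fun w => exp (f w)) z = exp (f z) * wirt s v f z := by
  simpa [mul_comm] using wirt_comp (hasDerivAt_exp (f z)).hasFDerivAt hf

theorem conj_wirt {f : E → ℂ} (hf : DifferentiableAt ℝ f z) :
    conj (wirt s v f z) = wirt (conj s) v (fun w => conj (f w)) z := by
  have h : fderiv ℝ (fun w => conj (f w)) z = (conjCLE : ℂ →L[ℝ] ℂ).comp (fderiv ℝ f z) :=
    (conjCLE.toContinuousLinearMap.hasFDerivAt.comp z hf.hasFDerivAt).fderiv
  simp [wirt, h, -one_div, -map_inv₀, Complex.conj_ofNat]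

theorem differentiableAt_of_contDiffOn {F : Type*} [NormedAddCommGroup F] [NormedSpace ℝ F]
    {f : E → F} (hU : IsOpen U) (hf : ContDiffOn ℝ ∞ f U) (hz : z ∈ U) :
    DifferentiableAt ℝ f z :=
  (hf.contDiffAt (hU.mem_nhds hz)).differentiableAt (by simp)

theorem wirt_contDiffOn (hU : IsOpen U) (hf : ContDiffOn ℝ ∞ f U) (s : ℂ) (v : E) :
    ContDiffOn ℝ ∞ (wirt s v f) U := by
  have h : ContDiffOn ℝ ∞ (fderiv ℝ f) U := hf.fderiv_of_isOpen hU (by simp)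
  exact ((h.clm_apply contDiffOn_const).add
    ((h.clm_apply contDiffOn_const).const_smul s)).const_smul (1 / 2 : ℂ)

theorem fderiv_wirt_apply (hU : IsOpen U) (hf : ContDiffOn ℝ ∞ f U) (hz : z ∈ U) (s : ℂ)
    (v w : E) :
    fderiv ℝ (wirt s v f) z w =
      (1 / 2 : ℂ) • (fderiv ℝ (fderiv ℝ f) z w v + s • fderiv ℝ (fderiv ℝ f) z w (I • v)) := by
  have h : ContDiffOn ℝ ∞ (fderiv ℝ f) U := hf.fderiv_of_isOpen hU (by simp)
  have h1 (u : E) : HasFDerivAt (fun y => fderiv ℝ f y u) ((fderiv ℝ (fderiv ℝ f) z).flip u) z := by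
    simpa using (differentiableAt_of_contDiffOn hU h hz).hasFDerivAt.clm_apply
      (hasFDerivAt_const u z)
  have h2 : fderiv ℝ (wirt s v f) z = _ :=
    (((h1 v).add ((h1 (I • v)).const_smul s)).const_smul (1 / 2 : ℂ)).fderiv
  simp [h2]

theorem norm_half_smul_add_le (L : E →L[ℝ] 𝔸) (hs : ‖s‖ = 1) :
    ‖(1 / 2 : ℂ) • (L v + s • L (I • v))‖ ≤ ‖L‖ * ‖v‖ := by
  have hI : ‖s • L (I • v)‖ ≤ ‖L‖ * ‖v‖ := by
    simpa [norm_smul, hs] using L.le_opNorm (I • v)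
  rw [norm_smul, norm_div, norm_one, RCLike.norm_ofNat]
  linarith [norm_add_le_of_le (L.le_opNorm v) hI]

theorem norm_wirt_le (hs : ‖s‖ = 1) : ‖wirt s v f z‖ ≤ ‖fderiv ℝ f z‖ * ‖v‖ :=
  norm_half_smul_add_le _ hs

theorem norm_wirt_wirt_le (hU : IsOpen U) (hf : ContDiffOn ℝ ∞ f U) (hz : z ∈ U) {s' : ℂ}
    (hs : ‖s‖ = 1) (hs' : ‖s'‖ = 1) (w : E) :
    ‖wirt s v (wirt s' w f) z‖ ≤ ‖fderiv ℝ (fderiv ℝ f) z‖ * ‖w‖ * ‖v‖ := by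
  have h (x : E) : ‖fderiv ℝ (wirt s' w f) z x‖ ≤ ‖fderiv ℝ (fderiv ℝ f) z‖ * ‖w‖ * ‖x‖ := by
    rw [fderiv_wirt_apply hU hf hz, mul_right_comm]
    exact (norm_half_smul_add_le _ hs').trans (mul_le_mul_of_nonneg_right
      ((fderiv ℝ (fderiv ℝ f) z).le_opNorm x) (norm_nonneg w))
  exact (norm_wirt_le hs).trans (mul_le_mul_of_nonneg_right
    (ContinuousLinearMap.opNorm_le_bound _ (by positivity) h) (norm_nonneg v))

theorem isSymmSndFDerivAt_of_contDiffOn {F : Type*} [NormedAddCommGroup F] [NormedSpace ℝ F]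
    {f : E → F} (hU : IsOpen U) (hf : ContDiffOn ℝ ∞ f U) (hz : z ∈ U) :
    IsSymmSndFDerivAt ℝ f z :=
  (hf.contDiffAt (hU.mem_nhds hz)).isSymmSndFDerivAt
    (by rw [minSmoothness_of_isRCLikeNormedField]; exact ENat.LEInfty.out)

theorem wirt_comm (hU : IsOpen U) (hf : ContDiffOn ℝ ∞ f U) (hz : z ∈ U) (s s' : ℂ) (v w : E) :
    wirt s v (wirt s' w f) z = wirt s' w (wirt s v f) z := by
  have hsymm := isSymmSndFDerivAt_of_contDiffOn hU hf hz
  rw [wirt, wirt]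
  simp only [fderiv_wirt_apply hU hf hz]
  rw [hsymm.eq v w, hsymm.eq v (I • w), hsymm.eq (I • v) w, hsymm.eq (I • v) (I • w)]
  module

theorem del_delbar_comm (hU : IsOpen U) (hf : ContDiffOn ℝ ∞ f U) (hz : z ∈ U) (v w : E) :
    ∂[v] (∂̄[v] (∂[w] (∂̄[w] f))) z = ∂[w] (∂̄[w] (∂[v] (∂̄[v] f))) z := by
  have hd (s v) := wirt_contDiffOn hU hf s v
  have hdd (s v s' v') := wirt_contDiffOn hU (hd s v) s' v'
  calc ∂[v] (∂̄[v] (∂[w] (∂̄[w] f))) z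
      = ∂[v] (∂[w] (∂̄[v] (∂̄[w] f))) z :=
        wirt_congr hU hz fun x hx => wirt_comm hU (hd I w) hx I (-I) v w
    _ = ∂[w] (∂[v] (∂̄[v] (∂̄[w] f))) z := wirt_comm hU (hdd I w I v) hz _ _ _ _
    _ = ∂[w] (∂[v] (∂̄[w] (∂̄[v] f))) z :=
        wirt_congr hU hz fun x hx => wirt_congr hU hx fun y hy => wirt_comm hU hf hy I I v w
    _ = ∂[w] (∂̄[w] (∂[v] (∂̄[v] f))) z :=
        wirt_congr hU hz fun x hx => wirt_comm hU (hd I v) hx (-I) I v w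

end Wirtinger

/-! ### Real functions and the maximum principle -/

section RealFunctions

variable {E : Type*} [NormedAddCommGroup E] [NormedSpace ℂ E] {φ : E → ℝ} {z : E} {U : Set E}

theorem contDiffOn_ofReal (hφ : ContDiffOn ℝ ∞ φ U) : ContDiffOn ℝ ∞ (fun w => (φ w : ℂ)) U :=
  ofRealCLM.contDiff.comp_contDiffOn hφ

theorem fderiv_ofReal (hφ : DifferentiableAt ℝ φ z) :
    fderiv ℝ (fun w => (φ w : ℂ)) z = ofRealCLM.comp (fderiv ℝ φ z) :=
  (ofRealCLM.hasFDerivAt.comp z hφ.hasFDerivAt).fderiv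

theorem delbar_ofReal (hφ : DifferentiableAt ℝ φ z) (v : E) :
    ∂̄[v] (fun w => (φ w : ℂ)) z = conj (∂[v] (fun w => (φ w : ℂ)) z) := by
  have hd : DifferentiableAt ℝ (fun w => (φ w : ℂ)) z := ofRealCLM.differentiableAt.comp z hφ
  rw [conj_wirt hd]
  simp

theorem wirt_ofReal_comp {η : ℝ → ℝ} {η' : ℝ} (hη : HasDerivAt η η' (φ z))
    (hφ : DifferentiableAt ℝ φ z) (s : ℂ) (v : E) :
    wirt s v (fun w => (η (φ w) : ℂ)) z = η' * wirt s v (fun w => (φ w : ℂ)) z := by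
  have h := hη.comp_hasFDerivAt z hφ.hasFDerivAt
  rw [wirt, fderiv_ofReal (φ := fun w => η (φ w)) h.differentiableAt, wirt, fderiv_ofReal hφ,
    show fderiv ℝ (fun w => η (φ w)) z = _ from h.fderiv]
  simp only [ContinuousLinearMap.comp_apply, smul_apply, smul_eq_mul, ofRealCLM_apply, ofReal_mul]
  ring

theorem re_del_delbar_ofReal_comp {η η' : ℝ → ℝ} {η'' : ℝ} (hU : IsOpen U)
    (hφ : ContDiffOn ℝ ∞ φ U) (hη : ∀ w ∈ U, HasDerivAt η (η' (φ w)) (φ w)) (hz : z ∈ U)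
    (hη' : HasDerivAt η' η'' (φ z)) (v : E) :
    (∂[v] (∂̄[v] fun w => (η (φ w) : ℂ)) z).re =
      η' (φ z) * (∂[v] (∂̄[v] fun w => (φ w : ℂ)) z).re +
        η'' * normSq (∂[v] (fun w => (φ w : ℂ)) z) := by
  have hd (w) (hw : w ∈ U) := differentiableAt_of_contDiffOn hU hφ hw
  have hη'd : DifferentiableAt ℝ (fun w => (η' (φ w) : ℂ)) z :=
    ofRealCLM.differentiableAt.comp z (hη'.differentiableAt.comp z (hd z hz))
  rw [wirt_congr hU hz fun w hw => wirt_ofReal_comp (hη w hw) (hd w hw) I v,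
    wirt_mul hη'd (differentiableAt_of_contDiffOn hU
      (wirt_contDiffOn hU (contDiffOn_ofReal hφ) I v) hz),
    wirt_ofReal_comp hη' (hd z hz), delbar_ofReal (hd z hz), mul_assoc, mul_conj, add_re,
    re_ofReal_mul, re_ofReal_mul, ofReal_re, add_comm]

theorem wirt_eq_zero_of_isLocalMax (hφ : DifferentiableAt ℝ φ z) (hmax : IsLocalMax φ z) (s : ℂ)
    (v : E) : wirt s v (fun w => (φ w : ℂ)) z = 0 := by
  simp [wirt, fderiv_ofReal hφ, hmax.fderiv_eq_zero]

theorem deriv_deriv_nonpos_of_isLocalMax {q : ℝ → ℝ} {t : ℝ} (hq : ContinuousAt q t)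
    (hmax : IsLocalMax q t) : deriv (deriv q) t ≤ 0 := by
  by_contra! h
  have hmin := isLocalMin_of_deriv_deriv_pos h hmax.deriv_eq_zero hq
  have hconst : q =ᶠ[nhds t] fun _ => q t := by
    filter_upwards [hmax, hmin] with x h1 h2 using le_antisymm h1 h2
  simp [hconst.deriv.deriv_eq] at h

theorem snd_fderiv_nonpos_of_isLocalMax (hU : IsOpen U) (hφ : ContDiffOn ℝ ∞ φ U) (hz : z ∈ U)
    (hmax : IsLocalMax φ z) (v : E) : fderiv ℝ (fderiv ℝ φ) z v v ≤ 0 := by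
  let γ : ℝ → E := fun t => z + t • v
  have hγ (t : ℝ) : HasDerivAt γ v t := by
    simpa [γ] using ((hasDerivAt_id t).smul_const v).const_add z
  have hγ0 : γ 0 = z := by simp [γ]
  have hcont : ContinuousAt γ 0 := (hγ 0).continuousAt
  have hd : deriv (φ ∘ γ) =ᶠ[nhds 0] fun t => fderiv ℝ φ (γ t) v := by
    filter_upwards [hcont.eventually_mem (by rw [hγ0]; exact hU.mem_nhds hz)] with t ht
    exact ((differentiableAt_of_contDiffOn hU hφ ht).hasFDerivAt.comp_hasDerivAt t (hγ t)).deriv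
  have hdd : deriv (deriv (φ ∘ γ)) 0 = fderiv ℝ (fderiv ℝ φ) z v v := by
    have h : HasFDerivAt (fun y => fderiv ℝ φ y v) ((fderiv ℝ (fderiv ℝ φ) z).flip v) (γ 0) := by
      simpa [hγ0] using (differentiableAt_of_contDiffOn hU
        (hφ.fderiv_of_isOpen (m := ∞) hU (by simp)) hz).hasFDerivAt.clm_apply
          (hasFDerivAt_const v z)
    rw [hd.deriv_eq]
    exact (h.comp_hasDerivAt (0 : ℝ) (hγ 0)).deriv
  rw [← hdd]
  refine deriv_deriv_nonpos_of_isLocalMax (ContinuousAt.comp ?_ hcont) ?_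
  · exact hγ0 ▸ (differentiableAt_of_contDiffOn hU hφ hz).continuousAt
  · have h := hcont.tendsto.eventually (hγ0 ▸ hmax : ∀ᶠ y in nhds (γ 0), φ y ≤ φ z)
    simpa [IsLocalMax, IsMaxFilter, hγ0] using h

theorem snd_fderiv_ofReal (hU : IsOpen U) (hφ : ContDiffOn ℝ ∞ φ U) (hz : z ∈ U) (v w : E) :
    fderiv ℝ (fderiv ℝ fun x => (φ x : ℂ)) z v w = (fderiv ℝ (fderiv ℝ φ) z v w : ℂ) := by
  have h1 : (fderiv ℝ fun x => (φ x : ℂ)) =ᶠ[nhds z] fun y => ofRealCLM.comp (fderiv ℝ φ y) := by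
    filter_upwards [hU.mem_nhds hz] with y hy
      using fderiv_ofReal (differentiableAt_of_contDiffOn hU hφ hy)
  have h2 : fderiv ℝ (fun y => ofRealCLM.comp (fderiv ℝ φ y)) z = _ :=
    ((ContinuousLinearMap.compL ℝ E ℝ ℂ ofRealCLM).hasFDerivAt.comp z
      (differentiableAt_of_contDiffOn hU (hφ.fderiv_of_isOpen (m := ∞) hU (by simp))
        hz).hasFDerivAt).fderiv
  rw [h1.fderiv_eq, h2]
  rfl

theorem re_del_delbar_nonpos_of_isLocalMax (hU : IsOpen U) (hφ : ContDiffOn ℝ ∞ φ U)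
    (hz : z ∈ U) (hmax : IsLocalMax φ z) (v : E) :
    (∂[v] (∂̄[v] fun w => (φ w : ℂ)) z).re ≤ 0 := by
  have hs := (isSymmSndFDerivAt_of_contDiffOn hU hφ hz).eq v (I • v)
  have key : ∂[v] (∂̄[v] fun w => (φ w : ℂ)) z = ((1 / 4 * (fderiv ℝ (fderiv ℝ φ) z v v +
      fderiv ℝ (fderiv ℝ φ) z (I • v) (I • v)) : ℝ) : ℂ) := by
    rw [wirt, fderiv_wirt_apply hU (contDiffOn_ofReal hφ) hz,
      fderiv_wirt_apply hU (contDiffOn_ofReal hφ) hz]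
    simp only [snd_fderiv_ofReal hU hφ hz, hs, smul_eq_mul]
    push_cast
    linear_combination (-1 / 4 * fderiv ℝ (fderiv ℝ φ) z (I • v) (I • v) : ℂ) * I_sq
  rw [key, ofReal_re]
  linarith [snd_fderiv_nonpos_of_isLocalMax hU hφ hz hmax v,
    snd_fderiv_nonpos_of_isLocalMax hU hφ hz hmax (I • v)]

end RealFunctions

/-! ### Derivatives of matrix-valued functions -/

section NormedAlgebra

variable {E 𝔸 : Type*} [NormedAddCommGroup E] [NormedSpace ℂ E] [NormedRing 𝔸] [NormedAlgebra ℂ 𝔸]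
  [CompleteSpace 𝔸] {a b : E → 𝔸} {U : Set E} {z : E} {s : ℂ} {v : E}

theorem contDiffOn_ringInverse (ha : ContDiffOn ℝ ∞ a U) (hu : ∀ z ∈ U, IsUnit (a z)) :
    ContDiffOn ℝ ∞ (fun z => (a z)⁻¹ʳ) U := by
  intro z hz
  obtain ⟨u, hu⟩ := hu z hz
  exact (hu ▸ contDiffAt_ringInverse ℝ u).comp_contDiffWithinAt z (ha z hz)

theorem wirt_ringInverse (ha : DifferentiableAt ℝ a z) (hu : IsUnit (a z)) :
    wirt s v (fun w => (a w)⁻¹ʳ) z = -((a z)⁻¹ʳ * wirt s v a z * (a z)⁻¹ʳ) := by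
  obtain ⟨u, hu⟩ := hu
  have h := hasFDerivAt_ringInverse (𝕜 := ℝ) u
  rw [hu] at h
  have hc : fderiv ℝ (fun w => (a w)⁻¹ʳ) z = _ := (h.comp z ha.hasFDerivAt).fderiv
  simp [wirt, hc, ← hu, mul_add, add_mul, add_comm]

theorem wirt_inverse_mul (ha : DifferentiableAt ℝ a z) (hb : DifferentiableAt ℝ b z)
    (hu : IsUnit (a z)) :
    wirt s v (fun w => (a w)⁻¹ʳ * b w) z =
      (a z)⁻¹ʳ * (wirt s v b z - wirt s v a z * ((a z)⁻¹ʳ * b z)) := by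
  rw [wirt_mul (ha.inverse hu) hb, wirt_ringInverse ha hu]
  noncomm_ring

theorem wirt_wirt_inverse_mul (hU : IsOpen U) (ha : ContDiffOn ℝ ∞ a U) (hb : ContDiffOn ℝ ∞ b U)
    (hu : ∀ z ∈ U, IsUnit (a z)) (hz : z ∈ U) (s s' : ℂ) (v w : E) :
    wirt s v (wirt s' w fun x => (a x)⁻¹ʳ * b x) z =
      (a z)⁻¹ʳ * (wirt s v (wirt s' w b) z - wirt s v (wirt s' w a) z * ((a z)⁻¹ʳ * b z)
        - wirt s' w a z * ((a z)⁻¹ʳ * (wirt s v b z - wirt s v a z * ((a z)⁻¹ʳ * b z)))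
        - wirt s v a z * ((a z)⁻¹ʳ * (wirt s' w b z - wirt s' w a z * ((a z)⁻¹ʳ * b z)))) := by
  have hd {c : E → 𝔸} (hc : ContDiffOn ℝ ∞ c U) {x} (hx : x ∈ U) : DifferentiableAt ℝ c x :=
    differentiableAt_of_contDiffOn hU hc hx
  have ha' := hd (wirt_contDiffOn hU ha s' w) hz
  have hb' := hd (wirt_contDiffOn hU hb s' w) hz
  have hab := hd ((contDiffOn_ringInverse ha hu).mul hb) hz
  rw [wirt_congr hU hz fun x hx => wirt_inverse_mul (hd ha hx) (hd hb hx) (hu x hx),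
    wirt_inverse_mul (hd ha hz) (hb'.fun_sub (ha'.fun_mul hab)) (hu z hz),
    wirt_sub hb' (ha'.fun_mul hab), wirt_mul ha' hab, wirt_inverse_mul (hd ha hz) (hd hb hz)
    (hu z hz), ← sub_sub]

end NormedAlgebra

section MatrixCalculus

open scoped Matrix.Norms.L2Operator

variable {E m : Type*} [NormedAddCommGroup E] [NormedSpace ℂ E] [Fintype m]
  [DecidableEq m]
  {A B : E → Matrix m m ℂ} {c : E → ℂ} {U : Set E} {z : E} {s : ℂ} {v : E}

theorem wirt_matrix_apply (hA : DifferentiableAt ℝ A z) (i j : m) :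
    wirt s v A z i j = wirt s v (fun w => A w i j) z :=
  (wirt_clm_comp (Matrix.entryLinearMap ℂ ℂ i j).toContinuousLinearMap hA).symm

theorem wirt_wirt_matrix_apply (hU : IsOpen U) (hA : ContDiffOn ℝ ∞ A U) (hz : z ∈ U) (s s' : ℂ)
    (v w : E) (i j : m) :
    wirt s v (wirt s' w A) z i j = wirt s v (wirt s' w fun x => A x i j) z := by
  rw [wirt_matrix_apply (differentiableAt_of_contDiffOn hU (wirt_contDiffOn hU hA s' w) hz)]
  exact wirt_congr hU hz fun x hx => wirt_matrix_apply (differentiableAt_of_contDiffOn hU hA hx) i j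

theorem wirt_trace (hA : DifferentiableAt ℝ A z) :
    wirt s v (fun w => (A w).trace) z = (wirt s v A z).trace :=
  wirt_clm_comp (Matrix.traceLinearMap m ℂ ℂ).toContinuousLinearMap hA

theorem delbar_isHermitian (hU : IsOpen U) (hA : ContDiffOn ℝ ∞ A U)
    (hH : ∀ w ∈ U, (A w).IsHermitian) (hz : z ∈ U) (v : E) : ∂̄[v] A z = (∂[v] A z)ᴴ := by
  have hd := differentiableAt_of_contDiffOn hU hA hz
  ext i j
  rw [Matrix.conjTranspose_apply, wirt_matrix_apply hd, wirt_matrix_apply hd, star_def, conj_wirt]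
  · simp only [map_neg, conj_I, neg_neg]
    exact wirt_congr hU hz fun w hw => ((hH w hw).apply i j).symm
  · exact ((Matrix.entryLinearMap ℂ ℂ j i).toContinuousLinearMap.restrictScalars
      ℝ).differentiableAt.comp z hd

theorem contDiffOn_matrix (hA : ∀ i j, ContDiffOn ℝ ∞ (fun z => A z i j) U) :
    ContDiffOn ℝ ∞ A U := by
  have h : A = fun z => ∑ i, ∑ j, A z i j • Matrix.single i j (1 : ℂ) := by
    ext1 z
    simpa [Matrix.smul_single] using Matrix.matrix_eq_sum_single (A z)
  rw [h]
  exact ContDiffOn.sum fun i _ => ContDiffOn.sum fun j _ => (hA i j).smul contDiffOn_const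

theorem contDiffOn_trace (hA : ContDiffOn ℝ ∞ A U) : ContDiffOn ℝ ∞ (fun z => (A z).trace) U :=
  ((Matrix.traceLinearMap m ℂ ℂ).toContinuousLinearMap.restrictScalars
    ℝ).contDiff.comp_contDiffOn hA

theorem hasFDerivAt_det_one : HasFDerivAt (𝕜 := ℂ) (Matrix.det : Matrix m m ℂ → ℂ)
    (Matrix.traceLinearMap m ℂ ℂ).toContinuousLinearMap 1 := by
  have hdet : DifferentiableAt ℂ (fun M : Matrix m m ℂ => M.det) 1 := by
    have h (i j : m) : DifferentiableAt ℂ (fun M : Matrix m m ℂ => M i j) 1 :=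
      (Matrix.entryLinearMap ℂ ℂ i j).toContinuousLinearMap.differentiableAt
    simp only [Matrix.det_apply']
    exact DifferentiableAt.fun_sum fun σ _ => (differentiableAt_const _).mul
      (HasFDerivAt.finsetProd fun i _ => (h (σ i) i).hasFDerivAt).differentiableAt
  convert! hdet.hasFDerivAt using 1
  ext M
  have hline : HasDerivAt (fun r : ℂ => (1 : Matrix m m ℂ) + r • M) M 0 := by
    have h := ((hasDerivAt_id (0 : ℂ)).smul_const M).const_add (1 : Matrix m m ℂ)
    rw [one_smul] at h
    exact h
  have hdet' : HasFDerivAt (𝕜 := ℂ) Matrix.det (fderiv ℂ Matrix.det (1 : Matrix m m ℂ))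
      (1 + (0 : ℂ) • M) := by
    rw [zero_smul, add_zero]
    exact hdet.hasFDerivAt
  refine HasDerivAt.unique ?_ (hdet'.comp_hasDerivAt (0 : ℂ) hline)
  rw [show Matrix.det ∘ (fun r : ℂ => 1 + r • M) = _ from
    funext fun r => Matrix.det_one_add_smul r M]
  simpa using! ((hasDerivAt_const (0 : ℂ) 1).add ((hasDerivAt_id (0 : ℂ)).const_mul M.trace)).add
    ((Polynomial.hasDerivAt _ (0 : ℂ)).mul ((hasDerivAt_id (0 : ℂ)).pow 2))

theorem hasFDerivAt_det {M : Matrix m m ℂ} (hM : IsUnit M) : HasFDerivAt (𝕜 := ℂ) Matrix.det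
    (M.det • (Matrix.traceLinearMap m ℂ ℂ).toContinuousLinearMap ∘SL
      (M⁻¹ʳ • ContinuousLinearMap.id ℂ _)) M := by
  have hdet : HasFDerivAt (𝕜 := ℂ) Matrix.det
      (Matrix.traceLinearMap m ℂ ℂ).toContinuousLinearMap (M⁻¹ʳ * M) := by
    rw [Ring.inverse_mul_cancel _ hM]
    exact hasFDerivAt_det_one
  have hG : (Matrix.det : Matrix m m ℂ → ℂ) = fun X => M.det * (M⁻¹ʳ * X).det := by
    ext X
    rw [← Matrix.det_mul, Ring.mul_inverse_cancel_left _ _ hM]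
  have h := (hdet.comp M ((hasFDerivAt_id (𝕜 := ℂ) M).const_mul M⁻¹ʳ)).const_mul M.det
  exact h.congr_of_eventuallyEq (Filter.EventuallyEq.of_eq hG)

/-- Jacobi's formula. -/
theorem wirt_det (hA : DifferentiableAt ℝ A z) (hu : IsUnit (A z)) :
    wirt s v (fun w => (A w).det) z = (A z).det * ((A z)⁻¹ʳ * wirt s v A z).trace :=
  wirt_comp (hasFDerivAt_det hu) hA

theorem trace_inverse_mul_wirt (hU : IsOpen U) (hA : ContDiffOn ℝ ∞ A U)
    (hB : ContDiffOn ℝ ∞ B U) (hc : ContDiffOn ℝ ∞ c U) (huA : ∀ z ∈ U, IsUnit (A z))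
    (huB : ∀ z ∈ U, IsUnit (B z)) (h : ∀ z ∈ U, (B z).det = exp (c z) * (A z).det) (hz : z ∈ U) :
    ((B z)⁻¹ʳ * wirt s v B z).trace = wirt s v c z + ((A z)⁻¹ʳ * wirt s v A z).trace := by
  have hA := differentiableAt_of_contDiffOn hU hA hz
  have hc := differentiableAt_of_contDiffOn hU hc hz
  have hdetA : DifferentiableAt ℝ (fun w => (A w).det) z :=
    ((hasFDerivAt_det (huA z hz)).restrictScalars ℝ).differentiableAt.comp z hA
  have key : (B z).det * ((B z)⁻¹ʳ * wirt s v B z).trace =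
      (B z).det * (wirt s v c z + ((A z)⁻¹ʳ * wirt s v A z).trace) := by
    rw [← wirt_det (differentiableAt_of_contDiffOn hU hB hz) (huB z hz), wirt_congr hU hz h,
      wirt_mul hc.cexp hdetA, wirt_exp hc, wirt_det hA (huA z hz), h z hz]
    ring
  exact mul_left_cancel₀ ((Matrix.isUnit_iff_isUnit_det _).mp (huB z hz)).ne_zero key

theorem wirt_trace_inverse_mul_wirt (hU : IsOpen U) (hA : ContDiffOn ℝ ∞ A U)
    (hu : ∀ z ∈ U, IsUnit (A z)) (hz : z ∈ U) (s s' : ℂ) (v w : E) :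
    wirt s v (fun x => ((A x)⁻¹ʳ * wirt s' w A x).trace) z =
      ((A z)⁻¹ʳ *
        (wirt s v (wirt s' w A) z - wirt s v A z * ((A z)⁻¹ʳ * wirt s' w A z))).trace := by
  have hA' := wirt_contDiffOn hU hA s' w
  rw [wirt_trace (differentiableAt_of_contDiffOn hU ((contDiffOn_ringInverse hA hu).mul hA') hz),
    wirt_inverse_mul (differentiableAt_of_contDiffOn hU hA hz)
      (differentiableAt_of_contDiffOn hU hA' hz) (hu z hz)]

theorem wirt_wirt_log_det (hU : IsOpen U) (hA : ContDiffOn ℝ ∞ A U) (hB : ContDiffOn ℝ ∞ B U)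
    (hc : ContDiffOn ℝ ∞ c U) (huA : ∀ z ∈ U, IsUnit (A z)) (huB : ∀ z ∈ U, IsUnit (B z))
    (h : ∀ z ∈ U, (B z).det = exp (c z) * (A z).det) (hz : z ∈ U) (s s' : ℂ) (v w : E) :
    ((B z)⁻¹ʳ *
        (wirt s v (wirt s' w B) z - wirt s v B z * ((B z)⁻¹ʳ * wirt s' w B z))).trace =
      wirt s v (wirt s' w c) z + ((A z)⁻¹ʳ *
        (wirt s v (wirt s' w A) z - wirt s v A z * ((A z)⁻¹ʳ * wirt s' w A z))).trace := by
  rw [← wirt_trace_inverse_mul_wirt hU hB huB hz, ← wirt_trace_inverse_mul_wirt hU hA huA hz,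
    wirt_congr hU hz fun x hx => trace_inverse_mul_wirt hU hA hB hc huA huB h hx]
  exact wirt_add (differentiableAt_of_contDiffOn hU (wirt_contDiffOn hU hc s' w) hz)
    (differentiableAt_of_contDiffOn hU (contDiffOn_trace
      ((contDiffOn_ringInverse hA huA).mul (wirt_contDiffOn hU hA s' w))) hz)

end MatrixCalculus

/-! ### Pairs of positive definite matrices -/

section PosDef

open scoped Matrix.Norms.L2Operator MatrixOrder

variable {ι : Type*} [Fintype ι] [DecidableEq ι] {G H P : Matrix ι ι ℂ}

theorem exists_simultaneous_diagonalization (hG : G.PosDef) (hH : H.PosDef) :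
    ∃ (P : Matrix ι ι ℂ) (eig : ι → ℝ), (∀ i, 0 < eig i) ∧ IsUnit P ∧ Pᴴ * G * P = 1 ∧
      Pᴴ * H * P = Matrix.diagonal fun i => (eig i : ℂ) := by
  obtain ⟨_, ⟨c, rfl⟩, rfl⟩ :=
    CStarAlgebra.isStrictlyPositive_iff_eq_star_mul_self.mp hG.isStrictlyPositive
  let Q : Matrix ι ι ℂ := ↑c⁻¹
  have hQ : (Qᴴ * H * Q).PosDef :=
    hH.conjTranspose_mul_mul_same (Matrix.mulVec_injective_of_isUnit c⁻¹.isUnit)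
  let V := hQ.isHermitian.eigenvectorUnitary
  have hV : star V.1 * V.1 = 1 := Unitary.coe_star_mul_self V
  have hVH := hQ.isHermitian.conjStarAlgAut_star_eigenvectorUnitary
  rw [Unitary.conjStarAlgAut_apply, Unitary.coe_star, star_star] at hVH
  refine ⟨Q * V, hQ.isHermitian.eigenvalues, hQ.eigenvalues_pos,
    c⁻¹.isUnit.mul (Unitary.toUnits V).isUnit, ?_, ?_⟩
  · have hcQ : c.1 * Q = 1 := c.mul_inv
    calc (Q * V.1)ᴴ * (star c.1 * c.1) * (Q * V.1)
        = star V.1 * (star (c.1 * Q) * (c.1 * Q)) * V.1 := by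
          simp only [← Matrix.star_eq_conjTranspose, star_mul, mul_assoc]
      _ = 1 := by rw [hcQ, star_one, one_mul, mul_one, hV]
  · calc (Q * V.1)ᴴ * H * (Q * V.1) = star V.1 * (Qᴴ * H * Q) * V.1 := by
          simp only [← Matrix.star_eq_conjTranspose, star_mul, mul_assoc]
      _ = _ := hVH

theorem trace_congruence_inv_mul (hP : IsUnit P) (G H : Matrix ι ι ℂ) :
    ((Pᴴ * G * P)⁻¹ʳ * (Pᴴ * H * P)).trace = (G⁻¹ʳ * H).trace := by
  have hdet : IsUnit P.det := (Matrix.isUnit_iff_isUnit_det P).mp hP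
  have hdet' : IsUnit Pᴴ.det := (Matrix.isUnit_iff_isUnit_det Pᴴ).mp hP.star
  simp only [← Matrix.nonsing_inv_eq_ringInverse, Matrix.mul_inv_rev]
  calc (P⁻¹ * (G⁻¹ * Pᴴ⁻¹) * (Pᴴ * H * P)).trace
      = (P⁻¹ * (G⁻¹ * (Pᴴ⁻¹ * Pᴴ) * H * P)).trace := by simp only [Matrix.mul_assoc]
    _ = (G⁻¹ * H).trace := by
      rw [Matrix.nonsing_inv_mul _ hdet', Matrix.mul_one, Matrix.trace_mul_comm, Matrix.mul_assoc,
        Matrix.mul_nonsing_inv _ hdet, Matrix.mul_one]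

theorem ringInverse_eq_mul_conjTranspose (h : Pᴴ * G * P = 1) : G⁻¹ʳ = P * Pᴴ := by
  rw [← Matrix.nonsing_inv_eq_ringInverse]
  refine Matrix.inv_eq_left_inv ?_
  rw [Matrix.mul_assoc, mul_eq_one_comm, h]

theorem trace_inv_mul_pos [Nonempty ι] (hG : G.PosDef) (hH : H.PosDef) :
    0 < (G⁻¹ʳ * H).trace.re := by
  obtain ⟨P, eig, heig, hP, h1, h2⟩ := exists_simultaneous_diagonalization hG hH
  rw [← trace_congruence_inv_mul hP, h1, h2, Ring.inverse_one, Matrix.one_mul,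
    Matrix.trace_diagonal, ← ofReal_sum, ofReal_re]
  exact Finset.sum_pos (fun i _ => heig i) Finset.univ_nonempty

theorem ofReal_re_trace_inv_mul (hG : G.IsHermitian) (hH : H.IsHermitian) :
    ((G⁻¹ʳ * H).trace.re : ℂ) = (G⁻¹ʳ * H).trace := by
  rw [← conj_eq_iff_re, ← Matrix.nonsing_inv_eq_ringInverse, starRingEnd_apply,
    ← Matrix.trace_conjTranspose, Matrix.conjTranspose_mul, hG.inv.eq, hH.eq, Matrix.trace_mul_comm]

theorem norm_mul_norm_of_congruence_eq_one (h : Pᴴ * G * P = 1) : ‖P‖ * ‖P‖ = ‖G⁻¹ʳ‖ := by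
  rw [ringInverse_eq_mul_conjTranspose h]
  exact CStarRing.norm_self_mul_star.symm

theorem norm_congruence_le (h : Pᴴ * G * P = 1) (X : Matrix ι ι ℂ) :
    ‖Pᴴ * X * P‖ ≤ ‖G⁻¹ʳ‖ * ‖X‖ := by
  have hP : ‖Pᴴ‖ = ‖P‖ := norm_star P
  calc ‖Pᴴ * X * P‖ ≤ ‖Pᴴ‖ * ‖X‖ * ‖P‖ := norm_mul₃_le
    _ = ‖G⁻¹ʳ‖ * ‖X‖ := by rw [hP, ← norm_mul_norm_of_congruence_eq_one h]; ring

theorem norm_apply_le_l2_opNorm (X : Matrix ι ι ℂ) (i j : ι) : ‖X i j‖ ≤ ‖X‖ := by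
  have h := Matrix.l2_opNorm_mulVec X (EuclideanSpace.single j 1)
  simp only [PiLp.norm_single, norm_one, mul_one] at h
  simpa using (PiLp.norm_apply_le _ i).trans h

end PosDef

/-! ### Local solutions of the Monge–Ampère equation -/

section LocalSolution

open scoped Matrix.Norms.L2Operator

variable {E ι : Type*} [NormedAddCommGroup E] [NormedSpace ℂ E]

/-- The matrix of the form `√-1 ∂∂̄f` in the frame `v`. -/
def hessian (v : ι → E) (f : E → ℝ) (z : E) : Matrix ι ι ℂ :=
  Matrix.of fun i j => ∂[v i] (∂̄[v j] fun w => (f w : ℂ)) z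

/-- The matrix of `g' = g + √-1 ∂∂̄φ` in the frame `v`, where `G` is the matrix of `g`. -/
def perturbedMetric (v : ι → E) (G : E → Matrix ι ι ℂ) (φ : E → ℝ) (z : E) : Matrix ι ι ℂ :=
  G z + hessian v φ z

variable [Fintype ι] {U : Set E} {v : ι → E} {G : E → Matrix ι ι ℂ} {φ F : E → ℝ}
  {z p : E}

theorem hessian_congruence (hU : IsOpen U) (hφ : ContDiffOn ℝ ∞ φ U) (hz : z ∈ U) (v : ι → E)
    (P : Matrix ι ι ℂ) :
    hessian (fun j => ∑ a, conj (P a j) • v a) φ z = Pᴴ * hessian v φ z * P := by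
  have hd (b) := differentiableAt_of_contDiffOn hU
    (wirt_contDiffOn hU (contDiffOn_ofReal hφ) I (v b)) hz
  ext j k
  rw [hessian, Matrix.of_apply, del_sum_smul, Matrix.mul_assoc, Matrix.mul_apply]
  refine Finset.sum_congr rfl fun a _ => ?_
  rw [wirt_congr hU hz fun w _ => delbar_sum_smul (fun b => conj (P b k)) v _ w,
    wirt_sum_smul _ hd, Matrix.mul_apply]
  simp only [conj_conj, smul_eq_mul, hessian, Matrix.of_apply, mul_comm, Matrix.conjTranspose_apply,
    star_def]

variable [DecidableEq ι]

theorem contDiffOn_hessian (hU : IsOpen U) (hφ : ContDiffOn ℝ ∞ φ U) (v : ι → E) :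
    ContDiffOn ℝ ∞ (hessian v φ) U :=
  contDiffOn_matrix fun i j =>
    wirt_contDiffOn hU (wirt_contDiffOn hU (contDiffOn_ofReal hφ) I (v j)) (-I) (v i)

/-- A solution on `U` of `det (g + √-1 ∂∂̄φ) = e^F det g`, where `G` is the matrix of the metric `g`
in the frame `v` of constant vector fields. -/
structure MongeAmpereOn (U : Set E) (v : ι → E) (G : E → Matrix ι ι ℂ) (φ F : E → ℝ) : Prop where
  isOpen : IsOpen U
  contDiffOn_metric : ContDiffOn ℝ ∞ G U
  contDiffOn_potential : ContDiffOn ℝ ∞ φ U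
  contDiffOn_logDensity : ContDiffOn ℝ ∞ F U
  posDef : ∀ z ∈ U, (G z).PosDef
  posDef' : ∀ z ∈ U, (perturbedMetric v G φ z).PosDef
  det_eq : ∀ z ∈ U, (perturbedMetric v G φ z).det = exp (F z) * (G z).det

/-- `tr_g g'`. -/
def traceMetric (v : ι → E) (G : E → Matrix ι ι ℂ) (φ : E → ℝ) (z : E) : ℝ :=
  ((G z)⁻¹ʳ * perturbedMetric v G φ z).trace.re

namespace MongeAmpereOn

variable (S : MongeAmpereOn U v G φ F)
include S

theorem contDiffOn_perturbedMetric : ContDiffOn ℝ ∞ (perturbedMetric v G φ) U :=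
  S.contDiffOn_metric.add (contDiffOn_hessian S.isOpen S.contDiffOn_potential v)

theorem ofReal_traceMetric (hz : z ∈ U) :
    (traceMetric v G φ z : ℂ) = ((G z)⁻¹ʳ * perturbedMetric v G φ z).trace :=
  ofReal_re_trace_inv_mul (S.posDef z hz).isHermitian (S.posDef' z hz).isHermitian

theorem contDiffOn_traceMetric : ContDiffOn ℝ ∞ (traceMetric v G φ) U :=
  reCLM.contDiff.comp_contDiffOn (contDiffOn_trace
    ((contDiffOn_ringInverse S.contDiffOn_metric fun z hz => (S.posDef z hz).isUnit).mul
      S.contDiffOn_perturbedMetric))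

theorem perturbedMetric_congruence (hz : z ∈ U) (P : Matrix ι ι ℂ) :
    perturbedMetric (fun j => ∑ a, conj (P a j) • v a) (fun z => Pᴴ * G z * P) φ z =
      Pᴴ * perturbedMetric v G φ z * P := by
  rw [perturbedMetric, hessian_congruence S.isOpen S.contDiffOn_potential hz, perturbedMetric,
    mul_add, add_mul]

theorem traceMetric_congruence (hz : z ∈ U) {P : Matrix ι ι ℂ} (hP : IsUnit P) :
    traceMetric (fun j => ∑ a, conj (P a j) • v a) (fun z => Pᴴ * G z * P) φ z =
      traceMetric v G φ z := by
  rw [traceMetric, S.perturbedMetric_congruence hz, trace_congruence_inv_mul hP, traceMetric]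

theorem congruence {P : Matrix ι ι ℂ} (hP : IsUnit P) :
    MongeAmpereOn U (fun j => ∑ a, conj (P a j) • v a) (fun z => Pᴴ * G z * P) φ F where
  isOpen := S.isOpen
  contDiffOn_metric := (contDiffOn_const.mul S.contDiffOn_metric).mul contDiffOn_const
  contDiffOn_potential := S.contDiffOn_potential
  contDiffOn_logDensity := S.contDiffOn_logDensity
  posDef z hz := (S.posDef z hz).conjTranspose_mul_mul_same (Matrix.mulVec_injective_of_isUnit hP)
  posDef' z hz := S.perturbedMetric_congruence hz P ▸
    (S.posDef' z hz).conjTranspose_mul_mul_same (Matrix.mulVec_injective_of_isUnit hP)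
  det_eq z hz := by
    simp only [S.perturbedMetric_congruence hz, Matrix.det_mul, S.det_eq z hz]
    ring

theorem wirt_perturbedMetric (hz : z ∈ U) (s : ℂ) (w : E) :
    wirt s w (perturbedMetric v G φ) z = wirt s w G z + wirt s w (hessian v φ) z :=
  wirt_add (differentiableAt_of_contDiffOn S.isOpen S.contDiffOn_metric hz)
    (differentiableAt_of_contDiffOn S.isOpen
      (contDiffOn_hessian S.isOpen S.contDiffOn_potential v) hz)

theorem wirt_wirt_perturbedMetric (hz : z ∈ U) (s s' : ℂ) (w w' : E) :
    wirt s w (wirt s' w' (perturbedMetric v G φ)) z =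
      wirt s w (wirt s' w' G) z + wirt s w (wirt s' w' (hessian v φ)) z := by
  have hd {A : E → Matrix ι ι ℂ} (hA : ContDiffOn ℝ ∞ A U) :=
    differentiableAt_of_contDiffOn S.isOpen (wirt_contDiffOn S.isOpen hA s' w') hz
  rw [wirt_congr S.isOpen hz fun x hx => S.wirt_perturbedMetric hx s' w']
  exact wirt_add (hd S.contDiffOn_metric)
    (hd (contDiffOn_hessian S.isOpen S.contDiffOn_potential v))

/-- The metrics `g` and `g'` have the same torsion. -/
theorem del_perturbedMetric_sub (hp : p ∈ U) (i k l : ι) :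
    ∂[v i] (perturbedMetric v G φ) p k l - ∂[v k] (perturbedMetric v G φ) p i l =
      ∂[v i] G p k l - ∂[v k] G p i l := by
  have hφ := contDiffOn_ofReal S.contDiffOn_potential
  have hd := differentiableAt_of_contDiffOn S.isOpen
    (contDiffOn_hessian S.isOpen S.contDiffOn_potential v) hp
  have hsymm : ∂[v i] (hessian v φ) p k l = ∂[v k] (hessian v φ) p i l := by
    rw [wirt_matrix_apply hd, wirt_matrix_apply hd]
    exact wirt_comm S.isOpen (wirt_contDiffOn S.isOpen hφ I (v l)) hp _ _ _ _
  simp only [S.wirt_perturbedMetric hp, Matrix.add_apply, hsymm, add_sub_add_right_eq_sub]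

theorem del_delbar_perturbedMetric_sub (hp : p ∈ U) (i k : ι) :
    ∂[v i] (∂̄[v i] (perturbedMetric v G φ)) p k k -
        ∂[v k] (∂̄[v k] (perturbedMetric v G φ)) p i i =
      ∂[v i] (∂̄[v i] G) p k k - ∂[v k] (∂̄[v k] G) p i i := by
  have hh := contDiffOn_hessian S.isOpen S.contDiffOn_potential v
  have hsymm : ∂[v i] (∂̄[v i] (hessian v φ)) p k k = ∂[v k] (∂̄[v k] (hessian v φ)) p i i := by
    rw [wirt_wirt_matrix_apply S.isOpen hh hp, wirt_wirt_matrix_apply S.isOpen hh hp]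
    exact del_delbar_comm S.isOpen (contDiffOn_ofReal S.contDiffOn_potential) hp (v i) (v k)
  simp only [S.wirt_wirt_perturbedMetric hp, Matrix.add_apply, hsymm, add_sub_add_right_eq_sub]

theorem prod_eq {eig : ι → ℝ} (hp : p ∈ U) (hG : G p = 1)
    (hH : perturbedMetric v G φ p = Matrix.diagonal fun i => (eig i : ℂ)) :
    ∏ i, eig i = Real.exp (F p) := by
  have h := S.det_eq p hp
  rw [hH, hG, Matrix.det_diagonal, Matrix.det_one, mul_one] at h
  exact_mod_cast h

end MongeAmpereOn
end LocalSolution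

section AdaptedFrame

open scoped Matrix.Norms.L2Operator

variable {ι : Type*} [Fintype ι]

theorem re_trace_conjTranspose_mul_add (X Y : Matrix ι ι ℂ) :
    (Xᴴ * Y + X * Yᴴ).trace.re = ∑ k, ∑ l, 2 * (conj (X k l) * Y k l).re := by
  have hconj : (X * Yᴴ).trace = conj (Xᴴ * Y).trace := by
    rw [← star_def, ← Matrix.trace_conjTranspose, Matrix.conjTranspose_mul,
      Matrix.conjTranspose_conjTranspose, Matrix.trace_mul_comm]
  rw [Matrix.trace_add, hconj, add_conj, ofReal_re, Matrix.trace, re_sum, Finset.sum_comm]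
  simp only [Matrix.diag_apply, Matrix.mul_apply, re_sum, Finset.mul_sum,
    Matrix.conjTranspose_apply, star_def]

theorem re_mul_conjTranspose_apply_self (X : Matrix ι ι ℂ) (k : ι) :
    ((X * Xᴴ) k k).re = ∑ l, normSq (X k l) := by
  simp only [Matrix.mul_apply, re_sum, Matrix.conjTranspose_apply, star_def, mul_conj, ofReal_re]

theorem re_conjTranspose_mul_apply_self (X : Matrix ι ι ℂ) (k : ι) :
    ((Xᴴ * X) k k).re = ∑ l, normSq (X l k) := by
  simp only [Matrix.mul_apply, re_sum, Matrix.conjTranspose_apply, star_def,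
    ← normSq_eq_conj_mul_self, ofReal_re]

variable [DecidableEq ι]

theorem ringInverse_diagonal {x : ι → ℝ} (hx : ∀ i, 0 < x i) :
    (Matrix.diagonal fun i => (x i : ℂ))⁻¹ʳ = Matrix.diagonal fun i => ((x i)⁻¹ : ℂ) := by
  rw [← Matrix.nonsing_inv_eq_ringInverse]
  refine Matrix.inv_eq_left_inv ?_
  rw [Matrix.diagonal_mul_diagonal, ← Matrix.diagonal_one]
  congr 1
  ext i
  exact inv_mul_cancel₀ (ofReal_ne_zero.2 (hx i).ne')

theorem re_trace_diagonal_mul (d : ι → ℝ) (X Y : Matrix ι ι ℂ) :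
    (Matrix.diagonal (fun i => (d i : ℂ)) *
        (Y - X * (Matrix.diagonal (fun i => (d i : ℂ)) * Xᴴ))).trace.re =
      ∑ i, d i * (Y i i).re - ∑ i, ∑ l, d i * d l * normSq (X i l) := by
  rw [Matrix.trace, re_sum, ← Finset.sum_sub_distrib]
  refine Finset.sum_congr rfl fun i _ => ?_
  rw [Matrix.diag_apply, Matrix.diagonal_mul, re_ofReal_mul, Matrix.sub_apply, sub_re, mul_sub,
    Matrix.mul_apply, re_sum, Finset.mul_sum]
  congr 1
  refine Finset.sum_congr rfl fun l _ => ?_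
  rw [Matrix.diagonal_mul, Matrix.conjTranspose_apply, star_def, mul_left_comm, mul_conj,
    ← ofReal_mul, ofReal_re, mul_assoc]

variable {E : Type*} [NormedAddCommGroup E] [NormedSpace ℂ E]
  {U : Set E} {v : ι → E} {G : E → Matrix ι ι ℂ} {φ F : E → ℝ} {p : E} {eig : ι → ℝ}

namespace MongeAmpereOn

/-- The jet of a solution at a point `p` at which the frame is unitary for `g` and diagonalizes
`g'`. -/
def jet (S : MongeAmpereOn U v G φ F) (hp : p ∈ U) (hG : G p = 1) (heig : ∀ i, 0 < eig i)
    (hH : perturbedMetric v G φ p = Matrix.diagonal fun i => (eig i : ℂ)) : MongeAmpereJet ι where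
  eig := eig
  dg i k l := ∂[v i] G p k l
  dg' i k l := ∂[v i] (perturbedMetric v G φ) p k l
  ddg i k := (∂[v i] (∂̄[v i] G) p k k).re
  ddg' i k := (∂[v i] (∂̄[v i] (perturbedMetric v G φ)) p k k).re
  F := F p
  ddF i := (hessian v F p i i).re
  eig_pos := heig
  torsion_eq := S.del_perturbedMetric_sub hp
  ddg_sub_ddg i k := by
    simp only [← sub_re, S.del_delbar_perturbedMetric_sub hp]
  prod_eig := S.prod_eq hp hG hH
  ddlogdet_eq k := by
    have h := congr_arg re (wirt_wirt_log_det S.isOpen S.contDiffOn_metric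
      S.contDiffOn_perturbedMetric (contDiffOn_ofReal S.contDiffOn_logDensity)
      (fun z hz => (S.posDef z hz).isUnit) (fun z hz => (S.posDef' z hz).isUnit)
      S.det_eq hp (-I) I (v k) (v k))
    have hone : (1 : Matrix ι ι ℂ)⁻¹ʳ = Matrix.diagonal fun _ => ((1 : ℝ) : ℂ) := by simp
    rw [delbar_isHermitian S.isOpen S.contDiffOn_metric
        (fun z hz => (S.posDef z hz).isHermitian) hp,
      delbar_isHermitian S.isOpen S.contDiffOn_perturbedMetric
        (fun z hz => (S.posDef' z hz).isHermitian) hp, add_re, hG, hH, hone,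
      ringInverse_diagonal heig] at h
    simp only [← ofReal_inv, re_trace_diagonal_mul] at h
    simpa [hessian, div_eq_inv_mul, mul_comm, add_sub_assoc] using h

variable (S : MongeAmpereOn U v G φ F) (hp : p ∈ U) (hG : G p = 1) (heig : ∀ i, 0 < eig i)
  (hH : perturbedMetric v G φ p = Matrix.diagonal fun i => (eig i : ℂ))

theorem jet_tr : (S.jet hp hG heig hH).tr = traceMetric v G φ p := by
  simp [traceMetric, hG, hH, Matrix.trace_diagonal, MongeAmpereJet.tr, jet]

theorem del_traceMetric (i : ι) :
    ∂[v i] (fun z => (traceMetric v G φ z : ℂ)) p = (S.jet hp hG heig hH).dtr i := by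
  have hG' := S.contDiffOn_metric
  have hH' := S.contDiffOn_perturbedMetric
  have hu := fun z hz => (S.posDef z hz).isUnit
  have hd {A : E → Matrix ι ι ℂ} (hA : ContDiffOn ℝ ∞ A U) :=
    differentiableAt_of_contDiffOn S.isOpen hA hp
  rw [wirt_congr S.isOpen hp fun z hz => S.ofReal_traceMetric hz,
    wirt_trace (hd ((contDiffOn_ringInverse hG' hu).mul hH')),
    wirt_inverse_mul (hd hG') (hd hH') (hu p hp), hG, hH]
  simp [Matrix.trace, MongeAmpereJet.dtr, jet]

theorem re_del_delbar_traceMetric (i : ι) :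
    (∂[v i] (∂̄[v i] fun z => (traceMetric v G φ z : ℂ)) p).re =
      (S.jet hp hG heig hH).ddtr i := by
  have hG' := S.contDiffOn_metric
  have hH' := S.contDiffOn_perturbedMetric
  have hu := fun z hz => (S.posDef z hz).isUnit
  have hGH := (contDiffOn_ringInverse hG' hu).mul hH'
  have hd {A : E → Matrix ι ι ℂ} (hA : ContDiffOn ℝ ∞ A U) {z} (hz : z ∈ U) :=
    differentiableAt_of_contDiffOn S.isOpen hA hz
  rw [wirt_congr S.isOpen hp fun z hz =>
      (wirt_congr S.isOpen hz fun y hy => S.ofReal_traceMetric hy).trans (wirt_trace (hd hGH hz)),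
    wirt_trace (hd (wirt_contDiffOn S.isOpen hGH I (v i)) hp),
    wirt_wirt_inverse_mul S.isOpen hG' hH' hu hp,
    delbar_isHermitian S.isOpen hG' (fun z hz => (S.posDef z hz).isHermitian) hp,
    delbar_isHermitian S.isOpen hH' (fun z hz => (S.posDef' z hz).isHermitian) hp, hG, hH]
  simp only [Ring.inverse_one, one_mul]
  set X := ∂[v i] G p
  set Y := ∂[v i] (perturbedMetric v G φ) p
  set Z := ∂[v i] (∂̄[v i] G) p
  set W := ∂[v i] (∂̄[v i] (perturbedMetric v G φ)) p
  have hsplit (D : Matrix ι ι ℂ) : W - Z * D - Xᴴ * (Y - X * D) - X * (Yᴴ - Xᴴ * D) =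
      W - (Xᴴ * Y + X * Yᴴ) + (X * Xᴴ + Xᴴ * X - Z) * D := by
    noncomm_ring
  rw [hsplit, Matrix.trace_add, Matrix.trace_sub, add_re, sub_re, re_trace_conjTranspose_mul_add]
  simp [Matrix.trace, re_mul_conjTranspose_apply_self, re_conjTranspose_mul_apply_self,
    MongeAmpereJet.ddtr, jet, X, Y, Z, W, mul_comm]

end MongeAmpereOn
end AdaptedFrame

/-! ### The test function at a local maximum -/

section LogAdd

variable {E : Type*} [NormedAddCommGroup E] [NormedSpace ℂ E] {u φ : E → ℝ} {U : Set E} {p : E}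
  {η η' : ℝ → ℝ}

theorem del_div_eq_of_isLocalMax {c : ℝ} (hu : DifferentiableAt ℝ u p)
    (hφ : DifferentiableAt ℝ φ p) (hpos : 0 < u p) (hη : HasDerivAt η c (φ p))
    (hmax : IsLocalMax (fun z => Real.log (u z) + η (φ z)) p) (v : E) :
    ∂[v] (fun z => (u z : ℂ)) p / u p = -c * ∂[v] (fun z => (φ z : ℂ)) p := by
  have hlog : DifferentiableAt ℝ (fun z => Real.log (u z)) p := hu.log hpos.ne'
  have hηφ : DifferentiableAt ℝ (fun z => η (φ z)) p := hη.differentiableAt.comp p hφ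
  have hd {f : E → ℝ} (hf : DifferentiableAt ℝ f p) : DifferentiableAt ℝ (fun z => (f z : ℂ)) p :=
    ofRealCLM.differentiableAt.comp p hf
  have h := wirt_eq_zero_of_isLocalMax (hlog.add hηφ) hmax (-I) v
  simp only [Pi.add_apply, ofReal_add] at h
  rw [wirt_add (hd hlog) (hd hηφ), wirt_ofReal_comp (Real.hasDerivAt_log hpos.ne') hu,
    wirt_ofReal_comp hη hφ] at h
  rw [neg_mul, ← eq_neg_of_add_eq_zero_left h, ofReal_inv, div_eq_inv_mul]

theorem re_del_delbar_add_nonpos_of_isLocalMax {c : ℝ} (hU : IsOpen U) (hu : ContDiffOn ℝ ∞ u U)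
    (hφ : ContDiffOn ℝ ∞ φ U) (hηφ : ContDiffOn ℝ ∞ (fun z => η (φ z)) U) (hp : p ∈ U)
    (hpos : ∀ z ∈ U, 0 < u z) (hη : ∀ z ∈ U, HasDerivAt η (η' (φ z)) (φ z))
    (hη' : HasDerivAt η' c (φ p))
    (hmax : IsLocalMax (fun z => Real.log (u z) + η (φ z)) p) (v : E) :
    (∂[v] (∂̄[v] fun z => (u z : ℂ)) p).re / u p -
        normSq (∂[v] (fun z => (u z : ℂ)) p) / u p ^ 2 +
      η' (φ p) * (∂[v] (∂̄[v] fun z => (φ z : ℂ)) p).re +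
        c * normSq (∂[v] (fun z => (φ z : ℂ)) p) ≤ 0 := by
  have hlog : ContDiffOn ℝ ∞ (fun z => Real.log (u z)) U := hu.log fun z hz => (hpos z hz).ne'
  have hd {f : E → ℝ} (hf : ContDiffOn ℝ ∞ f U) {z} (hz : z ∈ U) :=
    differentiableAt_of_contDiffOn hU (contDiffOn_ofReal hf) hz
  have hd' {f : E → ℝ} (hf : ContDiffOn ℝ ∞ f U) :=
    differentiableAt_of_contDiffOn hU (wirt_contDiffOn hU (contDiffOn_ofReal hf) I v) hp
  have h := re_del_delbar_nonpos_of_isLocalMax hU (hlog.add hηφ) hp hmax v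
  simp only [ofReal_add] at h
  rw [wirt_congr hU hp fun z hz => wirt_add (hd hlog hz) (hd hηφ hz), wirt_add (hd' hlog) (hd' hηφ),
    add_re, re_del_delbar_ofReal_comp hU hφ hη hp hη',
    re_del_delbar_ofReal_comp hU hu (fun z hz => Real.hasDerivAt_log (hpos z hz).ne') hp
      (hasDerivAt_inv (hpos p hp).ne')] at h
  calc _ = _ := by ring
    _ ≤ 0 := h

end LogAdd

section Barrier

/-- The function `t ↦ -A t + 1 / (t - m + 1)` of the potential that is added to `log (tr_g g')`. -/
def barrier (A m t : ℝ) : ℝ := -(A * t) + (t - m + 1)⁻¹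

variable {A m t : ℝ}

theorem hasDerivAt_inv_sub_add_one (ht : t - m + 1 ≠ 0) :
    HasDerivAt (fun t => (t - m + 1)⁻¹) (-(t - m + 1)⁻¹ ^ 2) t := by
  simpa [div_eq_mul_inv] using (((hasDerivAt_id' t).sub_const m).add_const 1).fun_inv ht

theorem hasDerivAt_barrier (ht : t - m + 1 ≠ 0) :
    HasDerivAt (barrier A m) (-(A + (t - m + 1)⁻¹ ^ 2)) t :=
  (((hasDerivAt_id' t).const_mul A).neg.add (hasDerivAt_inv_sub_add_one ht)).congr_deriv (by ring)

theorem hasDerivAt_deriv_barrier (ht : t - m + 1 ≠ 0) :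
    HasDerivAt (fun t => -(A + (t - m + 1)⁻¹ ^ 2)) (2 * (t - m + 1)⁻¹ ^ 3) t :=
  (((hasDerivAt_inv_sub_add_one ht).fun_pow 2).const_add A).fun_neg.congr_deriv (by
    generalize (t - m + 1)⁻¹ = r
    ring)

theorem isLocalMax_log_add_barrier {E : Type*} [NormedAddCommGroup E] [NormedSpace ℂ E]
    {u φ : E → ℝ} {U : Set E} {p : E} (hU : IsOpen U) (hu : ContDiffOn ℝ ∞ u U)
    (hφ : ContDiffOn ℝ ∞ φ U) (hp : p ∈ U) (hpos : ∀ z ∈ U, 0 < u z) (hm : ∀ z ∈ U, m ≤ φ z)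
    (hmax : IsLocalMax (fun z => Real.log (u z) + barrier A m (φ z)) p) (v : E) :
    ∂[v] (fun z => (u z : ℂ)) p / u p =
        (A + (φ p - m + 1)⁻¹ ^ 2 : ℝ) * ∂[v] (fun z => (φ z : ℂ)) p ∧
      (∂[v] (∂̄[v] fun z => (u z : ℂ)) p).re / u p -
          normSq (∂[v] (fun z => (u z : ℂ)) p) / u p ^ 2 -
        (A + (φ p - m + 1)⁻¹ ^ 2) * (∂[v] (∂̄[v] fun z => (φ z : ℂ)) p).re +
          2 * (φ p - m + 1)⁻¹ ^ 3 * normSq (∂[v] (fun z => (φ z : ℂ)) p) ≤ 0 := by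
  have hne {z} (hz : z ∈ U) : φ z - m + 1 ≠ 0 := by linarith [hm z hz]
  have hη {z} (hz : z ∈ U) := hasDerivAt_barrier (A := A) (hne hz)
  have hηφ : ContDiffOn ℝ ∞ (fun z => barrier A m (φ z)) U :=
    (contDiffOn_const.mul hφ).neg.add
      (((hφ.sub contDiffOn_const).add contDiffOn_const).inv fun z hz => hne hz)
  have hd {f : E → ℝ} (hf : ContDiffOn ℝ ∞ f U) := differentiableAt_of_contDiffOn hU hf hp
  constructor
  · rw [del_div_eq_of_isLocalMax (hd hu) (hd hφ) (hpos p hp) (hη hp) hmax, ofReal_neg, neg_neg]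
  · have h := re_del_delbar_add_nonpos_of_isLocalMax hU hu hφ hηφ hp hpos (fun z hz => hη hz)
      (hasDerivAt_deriv_barrier (hne hp)) hmax v
    rwa [neg_mul, ← sub_eq_add_neg] at h

end Barrier

section LocalMax

open scoped Matrix.Norms.L2Operator

variable {E ι : Type*} [DecidableEq ι] [NormedAddCommGroup E] [NormedSpace ℂ E]
  {U : Set E} {v : ι → E} {G : E → Matrix ι ι ℂ} {φ F : E → ℝ} {p : E} {A B K m : ℝ}

theorem re_hessian_diag {eig : ι → ℝ} (hG : G p = 1)
    (hH : perturbedMetric v G φ p = Matrix.diagonal fun i => (eig i : ℂ)) (i : ι) :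
    (hessian v φ p i i).re = eig i - 1 := by
  have h := congr_arg re (congr_fun (congr_fun hH i) i)
  rw [perturbedMetric, hG, Matrix.add_apply, Matrix.one_apply_eq, add_re, one_re,
    Matrix.diagonal_apply_eq, ofReal_re] at h
  linarith

variable [Fintype ι]

namespace MongeAmpereOn

theorem traceMetric_pos [Nonempty ι] (S : MongeAmpereOn U v G φ F) {z : E} (hz : z ∈ U) :
    0 < traceMetric v G φ z :=
  trace_inv_mul_pos (S.posDef z hz) (S.posDef' z hz)

theorem traceMetric_le_of_isLocalMax_of_jet [Nonempty ι] (S : MongeAmpereOn U v G φ F) (hp : p ∈ U)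
    {eig : ι → ℝ} (hG : G p = 1) (heig : ∀ i, 0 < eig i)
    (hH : perturbedMetric v G φ p = Matrix.diagonal fun i => (eig i : ℂ)) (hB0 : 0 ≤ B)
    (hB : (S.jet hp hG heig hH).BoundedBy B) (hFK : |F p| ≤ K)
    (hF : -K ≤ ∑ i, (hessian v F p i i).re) (hm : ∀ z ∈ U, m ≤ φ z)
    (hA : MongeAmpereJet.laplacianConst (Fintype.card ι) B K + 2 ≤ A)
    (hmax : IsLocalMax (fun z => Real.log (traceMetric v G φ z) + barrier A m (φ z)) p) :
    (φ p - m + 1)⁻¹ ^ 3 * traceMetric v G φ p ^ 2 ≤ ((A + 1) * (2 * Fintype.card ι * B)) ^ 2 ∨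
      traceMetric v G φ p ≤
        Fintype.card ι * (Real.exp K * (1 + (A + 1) * Fintype.card ι) ^ Fintype.card ι) := by
  have hcrit := isLocalMax_log_add_barrier S.isOpen S.contDiffOn_traceMetric S.contDiffOn_potential
    hp (fun z hz => S.traceMetric_pos hz) hm hmax
  set r := (φ p - m + 1)⁻¹
  have hr0 : 0 < r := inv_pos.2 (by linarith [hm p hp])
  have hr1 : r ≤ 1 := inv_le_one_of_one_le₀ (by linarith [hm p hp])
  have hr2 : r ^ 2 ≤ 1 := pow_le_one₀ hr0.le hr1
  have hA0 : 0 ≤ A := by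
    linarith [MongeAmpereJet.laplacianConst_nonneg (Fintype.card ι) hB0 ((abs_nonneg _).trans hFK)]
  have h := MongeAmpereJet.tr_le_of_max (J := S.jet hp hG heig hH) (a := A + r ^ 2)
    (b := 2 * r ^ 3) (dφ := fun i => ∂[v i] (fun z => (φ z : ℂ)) p) hB0 hB hFK hF
    (by nlinarith) (by positivity)
    (fun i => by rw [← S.del_traceMetric, jet_tr, (hcrit (v i)).1])
    (fun i => by
      rw [← S.del_traceMetric, ← S.re_del_delbar_traceMetric, jet_tr,
        show (S.jet hp hG heig hH).eig i - 1 = _ from (re_hessian_diag hG hH i).symm]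
      exact (hcrit (v i)).2)
  rw [jet_tr] at h
  refine h.imp (fun h => ?_) fun h => h.trans ?_
  · have hsq : ((A + r ^ 2) * (2 * Fintype.card ι * B)) ^ 2 ≤
        ((A + 1) * (2 * Fintype.card ι * B)) ^ 2 := by gcongr
    have hnonneg : 0 ≤ r ^ 3 * traceMetric v G φ p ^ 2 := by positivity
    linarith
  · gcongr

end MongeAmpereOn
end LocalMax

section ArbitraryFrame

open scoped Matrix.Norms.L2Operator

variable {E ι : Type*} [Fintype ι] [DecidableEq ι] [NormedAddCommGroup E] [NormedSpace ℂ E]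
  {U : Set E} {v : ι → E} {G : E → Matrix ι ι ℂ} {φ F : E → ℝ} {p : E} {A B K m : ℝ}
  {P : Matrix ι ι ℂ}

/-- A bound for the inverse of the metric `G` and for its derivatives up to order two at `p`. -/
def JetBound (B : ℝ) (G : E → Matrix ι ι ℂ) (p : E) : Prop :=
  ‖(G p)⁻¹ʳ‖ ≤ B ∧ ‖fderiv ℝ G p‖ ≤ B ∧ ‖fderiv ℝ (fderiv ℝ G) p‖ ≤ B

theorem wirt_mul_mul_const {s : ℂ} {w : E} (hG : DifferentiableAt ℝ G p) (P Q : Matrix ι ι ℂ) :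
    wirt s w (fun z => P * G z * Q) p = P * wirt s w G p * Q :=
  wirt_clm_comp (ContinuousLinearMap.mulLeftRight ℂ _ P Q) hG

theorem norm_frame_le (hv : ∀ c : ι → ℂ, ‖∑ a, c a • v a‖ ≤ ‖c‖) (P : Matrix ι ι ℂ) (j : ι) :
    ‖∑ a, conj (P a j) • v a‖ ≤ ‖P‖ :=
  (hv _).trans ((pi_norm_le_iff_of_nonneg (norm_nonneg P)).2 fun a => by
    rw [RCLike.norm_conj]
    exact norm_apply_le_l2_opNorm P a j)

theorem JetBound.nonneg (hB : JetBound B G p) : 0 ≤ B :=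
  (norm_nonneg _).trans hB.1

theorem JetBound.norm_del_congruence_le (hB : JetBound B G p) (hP : Pᴴ * G p * P = 1)
    (hv : ∀ c : ι → ℂ, ‖∑ a, c a • v a‖ ≤ ‖c‖) (hG : DifferentiableAt ℝ G p) (i : ι) :
    ‖∂[∑ a, conj (P a i) • v a] (fun z => Pᴴ * G z * P) p‖ ≤ (1 + B) ^ 3 := by
  have hPB : ‖P‖ * ‖P‖ ≤ B := (norm_mul_norm_of_congruence_eq_one hP).trans_le hB.1
  have hPB' : ‖P‖ ≤ 1 + B := by nlinarith [sq_nonneg (‖P‖ - 1)]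
  have hB0 := hB.nonneg
  rw [wirt_mul_mul_const hG]
  calc _ ≤ ‖(G p)⁻¹ʳ‖ * ‖∂[∑ a, conj (P a i) • v a] G p‖ := norm_congruence_le hP _
    _ ≤ B * (B * (1 + B)) := mul_le_mul hB.1 ((norm_wirt_le (by simp)).trans (mul_le_mul hB.2.1
        ((norm_frame_le hv P i).trans hPB') (norm_nonneg _) hB0)) (norm_nonneg _) hB0
    _ ≤ (1 + B) ^ 3 := by nlinarith [pow_nonneg hB0 2]

theorem JetBound.norm_del_delbar_congruence_le (hB : JetBound B G p) (hP : Pᴴ * G p * P = 1)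
    (hv : ∀ c : ι → ℂ, ‖∑ a, c a • v a‖ ≤ ‖c‖) (hU : IsOpen U) (hG : ContDiffOn ℝ ∞ G U)
    (hp : p ∈ U) (i : ι) :
    ‖∂[∑ a, conj (P a i) • v a] (∂̄[∑ a, conj (P a i) • v a] fun z => Pᴴ * G z * P) p‖ ≤
      (1 + B) ^ 3 := by
  set w := ∑ a, conj (P a i) • v a
  have hw : ‖w‖ * ‖w‖ ≤ B :=
    (mul_self_le_mul_self (norm_nonneg w) (norm_frame_le hv P i)).trans
      ((norm_mul_norm_of_congruence_eq_one hP).trans_le hB.1)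
  have hB0 := hB.nonneg
  have hd {A : E → Matrix ι ι ℂ} (hA : ContDiffOn ℝ ∞ A U) {z} (hz : z ∈ U) :=
    differentiableAt_of_contDiffOn hU hA hz
  rw [wirt_congr hU hp fun z hz => wirt_mul_mul_const (hd hG hz) Pᴴ P,
    wirt_mul_mul_const (hd (wirt_contDiffOn hU hG I w) hp)]
  calc _ ≤ ‖(G p)⁻¹ʳ‖ * ‖∂[w] (∂̄[w] G) p‖ := norm_congruence_le hP _
    _ ≤ B * (B * (‖w‖ * ‖w‖)) := by
      rw [← mul_assoc B ‖w‖]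
      refine mul_le_mul hB.1 ((norm_wirt_wirt_le hU hG hp (by simp) (by simp) w).trans ?_)
        (norm_nonneg _) hB0
      gcongr
      exact hB.2.2
    _ ≤ B * (B * B) := by gcongr
    _ ≤ (1 + B) ^ 3 := by nlinarith [pow_nonneg hB0 2]

theorem sum_re_hessian_frame (hU : IsOpen U) (hF : ContDiffOn ℝ ∞ F U) (hp : p ∈ U)
    (hP : Pᴴ * G p * P = 1) :
    ∑ i, (hessian (fun j => ∑ a, conj (P a j) • v a) F p i i).re =
      ((G p)⁻¹ʳ * hessian v F p).trace.re := by
  rw [ringInverse_eq_mul_conjTranspose hP, Matrix.mul_assoc, Matrix.trace_mul_comm,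
    ← hessian_congruence hU hF hp, Matrix.trace, re_sum]
  rfl

namespace MongeAmpereOn

theorem traceMetric_le_of_isLocalMax [Nonempty ι] (S : MongeAmpereOn U v G φ F) (hp : p ∈ U)
    (hv : ∀ c : ι → ℂ, ‖∑ a, c a • v a‖ ≤ ‖c‖) (hB : JetBound B G p) (hFK : |F p| ≤ K)
    (hF : -K ≤ ((G p)⁻¹ʳ * hessian v F p).trace.re) (hm : ∀ z ∈ U, m ≤ φ z)
    (hA : MongeAmpereJet.laplacianConst (Fintype.card ι) ((1 + B) ^ 3) K + 2 ≤ A)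
    (hmax : IsLocalMax (fun z => Real.log (traceMetric v G φ z) + barrier A m (φ z)) p) :
    (φ p - m + 1)⁻¹ ^ 3 * traceMetric v G φ p ^ 2 ≤
        ((A + 1) * (2 * Fintype.card ι * (1 + B) ^ 3)) ^ 2 ∨
      traceMetric v G φ p ≤
        Fintype.card ι * (Real.exp K * (1 + (A + 1) * Fintype.card ι) ^ Fintype.card ι) := by
  obtain ⟨P, eig, heig, hP, hPG, hPH⟩ :=
    exists_simultaneous_diagonalization (S.posDef p hp) (S.posDef' p hp)
  have hmax' : IsLocalMax (fun z => Real.log (traceMetric (fun j => ∑ a, conj (P a j) • v a)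
      (fun z => Pᴴ * G z * P) φ z) + barrier A m (φ z)) p := by
    refine hmax.congr ?_
    filter_upwards [S.isOpen.mem_nhds hp] with z hz
    rw [S.traceMetric_congruence hz hP]
  have hB0 := hB.nonneg
  rw [← S.traceMetric_congruence hp hP]
  refine (S.congruence hP).traceMetric_le_of_isLocalMax_of_jet hp hPG heig
    ((S.perturbedMetric_congruence hp P).trans hPH) (by positivity) ⟨fun i k l => ?_, fun i k => ?_⟩
    hFK ?_ hm hA hmax'
  · exact (norm_apply_le_l2_opNorm _ k l).trans (hB.norm_del_congruence_le hPG hv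
      (differentiableAt_of_contDiffOn S.isOpen S.contDiffOn_metric hp) i)
  · exact (abs_re_le_norm _).trans ((norm_apply_le_l2_opNorm _ k k).trans
      (hB.norm_del_delbar_congruence_le hPG hv S.isOpen S.contDiffOn_metric hp i))
  · rwa [sum_re_hessian_frame S.isOpen S.contDiffOn_logDensity hp hPG]

end MongeAmpereOn
end ArbitraryFrame

/-! ### Holomorphic changes of coordinates -/

section HolomorphicChange

variable {E E' 𝔸 ι : Type*} [NormedAddCommGroup E] [NormedSpace ℂ E] [NormedAddCommGroup E']
  [NormedSpace ℂ E'] [NormedAddCommGroup 𝔸] [NormedSpace ℂ 𝔸] {V : Set E'} {W : Set E}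
  {ψ : E → E'} {z : E}

theorem wirt_comp_holomorphic {f : E' → 𝔸} (hf : DifferentiableAt ℝ f (ψ z))
    (hψ : DifferentiableAt ℂ ψ z) (s : ℂ) (v : E) :
    wirt s v (fun w => f (ψ w)) z = wirt s (fderiv ℂ ψ z v) f (ψ z) := by
  have h : fderiv ℝ (fun w => f (ψ w)) z = _ :=
    (hf.hasFDerivAt.comp z (hψ.hasFDerivAt.restrictScalars ℝ)).fderiv
  simp [wirt, h]

/-- The term containing the derivative of `b` drops out, because `∂̄` is conjugate-linear in the
direction and `b` is holomorphic. -/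
theorem del_delbar_comp_holomorphic_vec {f : E' → 𝔸} {b : E → E'} (hV : IsOpen V)
    (hf : ContDiffOn ℝ ∞ f V) (hz : ψ z ∈ V) (hψ : DifferentiableAt ℂ ψ z)
    (hb : DifferentiableAt ℂ b z) (v : E) :
    ∂[v] (fun w => ∂̄[b w] f (ψ w)) z = ∂[v] (fun w => ∂̄[b z] f (ψ w)) z := by
  have hdf := differentiableAt_of_contDiffOn hV (hf.fderiv_of_isOpen hV (m := ∞) (by simp)) hz
  have hψ' := hψ.hasFDerivAt.restrictScalars ℝ
  have hb' := hb.hasFDerivAt.restrictScalars ℝ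
  have hL : HasFDerivAt (fun w => fderiv ℝ f (ψ w)) _ z := hdf.hasFDerivAt.comp z hψ'
  have h1 := ((hL.clm_apply hb').add ((hL.clm_apply (hb'.const_smul I)).const_smul I)).const_smul
    (1 / 2 : ℂ)
  have h2 := ((hL.clm_apply (hasFDerivAt_const (b z) z)).add
    ((hL.clm_apply (hasFDerivAt_const (I • b z) z)).const_smul I)).const_smul (1 / 2 : ℂ)
  have key (u : E) : fderiv ℝ (fun w => ∂̄[b w] f (ψ w)) z u =
      fderiv ℝ (fun w => ∂̄[b z] f (ψ w)) z u + ∂̄[fderiv ℂ b z u] f (ψ z) := by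
    rw [show fderiv ℝ (fun w => ∂̄[b w] f (ψ w)) z = _ from h1.fderiv,
      show fderiv ℝ (fun w => ∂̄[b z] f (ψ w)) z = _ from h2.fderiv]
    simp only [wirt, one_div, Pi.smul_apply, smul_add, add_apply, smul_apply,
      ContinuousLinearMap.comp_apply, ContinuousLinearMap.coe_restrictScalars',
      ContinuousLinearMap.flip_apply, ContinuousLinearMap.comp_zero, zero_add]
    module
  rw [wirt, wirt, key, key, (fderiv ℂ b z).map_smul, delbar_smul, conj_I, smul_add (-I),
    smul_smul (-I) (-I), neg_mul_neg, I_mul_I]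
  module

theorem hessian_comp_holomorphic {f : E' → ℝ} (hV : IsOpen V) (hf : ContDiffOn ℝ ∞ f V)
    (hW : IsOpen W) (hψ : ContDiffOn ℂ ω ψ W) (hmaps : MapsTo ψ W V) (hz : z ∈ W) (v : ι → E) :
    hessian v (f ∘ ψ) z = hessian (fun i => fderiv ℂ ψ z (v i)) f (ψ z) := by
  have hfc := contDiffOn_ofReal hf
  have hψd (w) (hw : w ∈ W) : DifferentiableAt ℂ ψ w :=
    (hψ.contDiffAt (hW.mem_nhds hw)).differentiableAt (by simp)
  have hψ' : DifferentiableAt ℂ (fderiv ℂ ψ) z :=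
    ((hψ.contDiffAt (hW.mem_nhds hz)).fderiv_right (m := 1) (by simp)).differentiableAt one_ne_zero
  ext i j
  calc ∂[v i] (∂̄[v j] fun w => (f (ψ w) : ℂ)) z
      = ∂[v i] (fun w => ∂̄[fderiv ℂ ψ w (v j)] (fun y => (f y : ℂ)) (ψ w)) z :=
        wirt_congr hW hz fun w hw => wirt_comp_holomorphic
          (differentiableAt_of_contDiffOn hV hfc (hmaps hw)) (hψd w hw) I (v j)
    _ = ∂[v i] (fun w => ∂̄[fderiv ℂ ψ z (v j)] (fun y => (f y : ℂ)) (ψ w)) z :=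
        del_delbar_comp_holomorphic_vec hV hfc (hmaps hz) (hψd z hz)
          (hψ'.clm_apply (differentiableAt_const _)) (v i)
    _ = ∂[fderiv ℂ ψ z (v i)] (∂̄[fderiv ℂ ψ z (v j)] fun y => (f y : ℂ)) (ψ z) :=
        wirt_comp_holomorphic
          (differentiableAt_of_contDiffOn hV (wirt_contDiffOn hV hfc I _) (hmaps hz)) (hψd z hz) _ _

end HolomorphicChange

/-! ### Hermitian metrics in holomorphic charts -/

section Charts

variable {n : ℕ} {M : Type*} [TopologicalSpace M]

theorem isOpen_transition_domain (e e' : OpenPartialHomeomorph M (Cn n)) :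
    IsOpen (e'.target ∩ e'.symm ⁻¹' e.source) :=
  e'.isOpen_inter_preimage_symm e.open_source

variable [ChartedSpace (Cn n) M] {e e' : OpenPartialHomeomorph M (Cn n)} {z : Cn n}

theorem contDiffOn_transition (he : e ∈ holCharts n M) (he' : e' ∈ holCharts n M) :
    ContDiffOn ℂ ω (e ∘ e'.symm) (e'.target ∩ e'.symm ⁻¹' e.source) := by
  rw [← contMDiffOn_iff_contDiffOn]
  exact (contMDiffOn_of_mem_maximalAtlas he).comp
    ((contMDiffOn_symm_of_mem_maximalAtlas he').mono inter_subset_left) fun z hz => hz.2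

/-- The differential of `e⁻¹`. Identifying the tangent spaces of `M` with `ℂⁿ` makes it possible to
compare the values at equal points of `M` that are not definitionally equal. -/
def symmDeriv (e : OpenPartialHomeomorph M (Cn n)) (z : Cn n) : Cn n →L[ℂ] Cn n :=
  mfderiv 𝓘(ℂ, Cn n) 𝓘(ℂ, Cn n) e.symm z

theorem symmDeriv_transition (he : e ∈ holCharts n M) (he' : e' ∈ holCharts n M)
    (hz : z ∈ e'.target ∩ e'.symm ⁻¹' e.source) (v : Cn n) :
    symmDeriv e' z v = symmDeriv e (e (e'.symm z)) (fderiv ℂ (e ∘ e'.symm) z v) := by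
  have hopen := isOpen_transition_domain e e'
  have h : (e'.symm : Cn n → M) =ᶠ[nhds z] e.symm ∘ e ∘ e'.symm := by
    filter_upwards [hopen.mem_nhds hz] with w hw using (e.left_inv hw.2).symm
  have he_symm : MDifferentiableAt 𝓘(ℂ, Cn n) 𝓘(ℂ, Cn n) e.symm (e (e'.symm z)) :=
    (contMDiffAt_symm_of_mem_maximalAtlas he (e.map_source hz.2)).mdifferentiableAt (by simp)
  have htrans : DifferentiableAt ℂ (e ∘ e'.symm) z :=
    ((contDiffOn_transition he he').contDiffAt (hopen.mem_nhds hz)).differentiableAt (by simp)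
  rw [symmDeriv, h.mfderiv_eq, mfderiv_comp z he_symm htrans.mdifferentiableAt, mfderiv_eq_fderiv]
  rfl

theorem symmDeriv_injective (he : e ∈ holCharts n M) (hz : z ∈ e.target) :
    Injective (symmDeriv e z) := by
  have h_symm : MDifferentiableAt 𝓘(ℂ, Cn n) 𝓘(ℂ, Cn n) e.symm z :=
    (contMDiffAt_symm_of_mem_maximalAtlas he hz).mdifferentiableAt (by simp)
  have he' : MDifferentiableAt 𝓘(ℂ, Cn n) 𝓘(ℂ, Cn n) e (e.symm z) :=
    (contMDiffAt_of_mem_maximalAtlas he (e.map_target hz)).mdifferentiableAt (by simp)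
  have hid : (e ∘ e.symm : Cn n → Cn n) =ᶠ[nhds z] id := by
    filter_upwards [e.open_target.mem_nhds hz] with w hw using e.right_inv hw
  have hcomp := mfderiv_comp z he' h_symm
  rw [hid.mfderiv_eq, mfderiv_id] at hcomp
  exact LeftInverse.injective (g := (mfderiv 𝓘(ℂ, Cn n) 𝓘(ℂ, Cn n) e (e.symm z) : Cn n → Cn n))
    fun v => (congrArg (fun T : Cn n →L[ℂ] Cn n => T v) hcomp).symm

variable [IsManifold 𝓘(ℂ, Cn n) ω M]

theorem chartAt_mem_holCharts (x : M) : chartAt (Cn n) x ∈ holCharts n M :=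
  IsManifold.chart_mem_maximalAtlas x

theorem contDiffOn_comp_symm {f : M → ℝ} (hf : ContMDiff 𝓘(ℝ, Cn n) 𝓘(ℝ, ℝ) ∞ f)
    (he : e ∈ holCharts n M) : ContDiffOn ℝ ∞ (f ∘ e.symm) e.target := by
  intro z hz
  set c := chartAt (Cn n) (e.symm z)
  have hopen := isOpen_transition_domain c e
  have hmem : z ∈ e.target ∩ e.symm ⁻¹' c.source := ⟨hz, mem_chart_source _ _⟩
  have hfc : ContDiffAt ℝ ∞ (f ∘ c.symm) (c (e.symm z)) := by
    have h := (contMDiffAt_iff.1 (hf (e.symm z))).2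
    simp only [mfld_simps] at h
    rwa [contDiffWithinAt_univ] at h
  have hce : ContDiffAt ℝ ∞ (c ∘ e.symm) z :=
    (((contDiffOn_transition (chartAt_mem_holCharts _) he).contDiffAt
      (hopen.mem_nhds hmem)).restrict_scalars ℝ).of_le le_top
  have hf_eq : f ∘ e.symm =ᶠ[nhds z] (f ∘ c.symm) ∘ c ∘ e.symm := by
    filter_upwards [hopen.mem_nhds hmem] with w hw using congrArg f (c.left_inv hw.2).symm
  exact ((hfc.comp z hce).congr_of_eventuallyEq hf_eq).contDiffWithinAt

end Charts

section Metric

open scoped Matrix.Norms.L2Operator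

theorem sesquilinear_sum_smul {ι V : Type*} [Fintype ι] [AddCommGroup V] [Module ℂ V]
    (b : V →ₗ[ℂ] V →ₗ⋆[ℂ] ℂ) (v : ι → V) (P : Matrix ι ι ℂ) :
    (Matrix.of fun i j => b (∑ a, conj (P a i) • v a) (∑ a, conj (P a j) • v a)) =
      Pᴴ * (Matrix.of fun i j => b (v i) (v j)) * P := by
  ext i j
  simp only [Matrix.of_apply, map_sum, map_smul, LinearMap.sum_apply, LinearMap.smul_apply,
    smul_eq_mul, LinearMap.map_smulₛₗ, conj_conj, Matrix.mul_apply, Matrix.conjTranspose_apply,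
    star_def, Finset.sum_mul, Finset.mul_sum]
  exact Finset.sum_congr rfl fun a _ => Finset.sum_congr rfl fun b _ => by ring

theorem posDef_of_sesquilinear {ι V : Type*} [Finite ι] [AddCommGroup V] [Module ℂ V]
    {b : V →ₗ[ℂ] V →ₗ⋆[ℂ] ℂ} (hsymm : ∀ x y, b y x = conj (b x y))
    (hpos : ∀ x, x ≠ 0 → 0 < (b x x).re) {v : ι → V} (hv : LinearIndependent ℂ v) :
    (Matrix.of fun i j => b (v i) (v j)).PosDef := by
  have := Fintype.ofFinite ι
  refine Matrix.PosDef.of_dotProduct_mulVec_pos ?_ fun x hx => ?_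
  · ext i j
    exact (congrArg conj (hsymm _ _)).trans (conj_conj _)
  · have hw : ∑ a, conj (x a) • v a ≠ 0 := fun h =>
      hx (funext fun a => by simpa using Fintype.linearIndependent_iff.1 hv _ h a)
    have hb : star x ⬝ᵥ ((Matrix.of fun i j => b (v i) (v j)) *ᵥ x) =
        b (∑ a, conj (x a) • v a) (∑ a, conj (x a) • v a) := by
      simp only [dotProduct, Matrix.mulVec, Matrix.of_apply, Finset.mul_sum, map_sum, map_smul,
        LinearMap.sum_apply, LinearMap.smul_apply, LinearMap.map_smulₛₗ, smul_eq_mul, conj_conj,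
        Pi.star_apply, star_def]
      rw [Finset.sum_comm]
      exact Finset.sum_congr rfl fun a _ => Finset.sum_congr rfl fun b _ => by ring
    rw [hb, Complex.pos_iff]
    exact ⟨hpos _ hw, (conj_eq_iff_im.1 (hsymm _ _).symm).symm⟩

/-- The coordinate frame `∂/∂z¹, …, ∂/∂zⁿ` of `ℂⁿ`. -/
def coordFrame (n : ℕ) (i : Fin n) : Cn n :=
  Pi.single i 1

theorem eq_sum_smul_coordFrame {n : ℕ} (c : Cn n) : c = ∑ a, c a • coordFrame n a := by
  have h := (Pi.basisFun ℂ (Fin n)).sum_repr c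
  simp only [Pi.basisFun_repr, Pi.basisFun_apply] at h
  exact h.symm

theorem linearIndependent_coordFrame (n : ℕ) : LinearIndependent ℂ (coordFrame n) := by
  have h : ⇑(Pi.basisFun ℂ (Fin n)) = coordFrame n := funext fun i => Pi.basisFun_apply ℂ (Fin n) i
  exact h ▸ (Pi.basisFun ℂ (Fin n)).linearIndependent

variable {n : ℕ} {M : Type*} [TopologicalSpace M]

theorem complexHessian_eq_hessian (e : OpenPartialHomeomorph M (Cn n)) (f : M → ℝ) (z : Cn n) :
    complexHessian e f z = hessian (coordFrame n) (f ∘ e.symm) z := by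
  have hI (i : Fin n) : I • coordFrame n i = Pi.single i I := by
    rw [coordFrame, ← Pi.single_smul, smul_eq_mul, mul_one]
  have hd (i : Fin n) (f : Cn n → ℂ) : dWirt i f = ∂[coordFrame n i] f := by
    ext1 z
    rw [dWirt, wirt, hI, smul_eq_mul, neg_smul, smul_eq_mul, sub_eq_add_neg, coordFrame]
  have hdbar (i : Fin n) (f : Cn n → ℂ) : dbarWirt i f = ∂̄[coordFrame n i] f := by
    ext1 z
    rw [dbarWirt, wirt, hI, smul_eq_mul, smul_eq_mul, coordFrame]
  ext i j
  rw [complexHessian, Matrix.of_apply, hd, hdbar, hessian, Matrix.of_apply]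
  rfl

/-- The complex conjugate of the Jacobian matrix of `e ∘ e'⁻¹`, which is the matrix of the change of
coordinate frames in the convention of `hessian_congruence`. -/
def transitionMatrix (e e' : OpenPartialHomeomorph M (Cn n)) (z : Cn n) :
    Matrix (Fin n) (Fin n) ℂ :=
  Matrix.of fun a i => conj (fderiv ℂ (e ∘ e'.symm) z (coordFrame n i) a)

theorem fderiv_transition_coordFrame (e e' : OpenPartialHomeomorph M (Cn n)) (z : Cn n)
    (i : Fin n) :
    fderiv ℂ (e ∘ e'.symm) z (coordFrame n i) =
      ∑ a, conj (transitionMatrix e e' z a i) • coordFrame n a := by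
  simpa only [transitionMatrix, Matrix.of_apply, conj_conj] using eq_sum_smul_coordFrame _

variable [ChartedSpace (Cn n) M] {e e' : OpenPartialHomeomorph M (Cn n)} {z : Cn n} {F φ : M → ℝ}
  (g : HermitianMetric n M)

theorem coeff'_eq_perturbedMetric (φ : M → ℝ) (e : OpenPartialHomeomorph M (Cn n)) (z : Cn n) :
    g.coeff' φ e z = perturbedMetric (coordFrame n) (g.coeff e) (φ ∘ e.symm) z := by
  rw [HermitianMetric.coeff', complexHessian_eq_hessian, perturbedMetric]

theorem traceMetricIn_eq_traceMetric (φ : M → ℝ) (e : OpenPartialHomeomorph M (Cn n)) (z : Cn n) :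
    g.traceMetricIn e φ z = traceMetric (coordFrame n) (g.coeff e) (φ ∘ e.symm) z := by
  rw [HermitianMetric.traceMetricIn, HermitianMetric.traceIn, coeff'_eq_perturbedMetric,
    Matrix.nonsing_inv_eq_ringInverse, traceMetric]

theorem laplacianIn_eq (f : M → ℝ) (e : OpenPartialHomeomorph M (Cn n)) (z : Cn n) :
    g.laplacianIn e f z =
      ((g.coeff e z)⁻¹ʳ * hessian (coordFrame n) (f ∘ e.symm) z).trace.re := by
  rw [HermitianMetric.laplacianIn, HermitianMetric.traceIn, complexHessian_eq_hessian,
    Matrix.nonsing_inv_eq_ringInverse]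

theorem coeff_posDef (he : e ∈ holCharts n M) (hz : z ∈ e.target) : (g.coeff e z).PosDef :=
  posDef_of_sesquilinear (V := Cn n) (b := g.form (e.symm z)) (g.symm _) (g.pos _)
    (v := fun i => symmDeriv e z (coordFrame n i))
    ((linearIndependent_coordFrame n).map' (symmDeriv e z).toLinearMap
      (LinearMap.ker_eq_bot.2 (symmDeriv_injective he hz)))

theorem contDiffOn_coeff (he : e ∈ holCharts n M) : ContDiffOn ℝ ∞ (g.coeff e) e.target :=
  contDiffOn_matrix (g.smooth e he)

theorem coeff_transition (he : e ∈ holCharts n M) (he' : e' ∈ holCharts n M)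
    (hz : z ∈ e'.target ∩ e'.symm ⁻¹' e.source) :
    g.coeff e' z = (transitionMatrix e e' z)ᴴ * g.coeff e (e (e'.symm z)) *
      transitionMatrix e e' z := by
  let b (x : M) : Cn n →ₗ[ℂ] Cn n →ₗ⋆[ℂ] ℂ := g.form x
  have hb (e : OpenPartialHomeomorph M (Cn n)) (z : Cn n) : g.coeff e z = Matrix.of fun i j =>
      b (e.symm z) (symmDeriv e z (coordFrame n i)) (symmDeriv e z (coordFrame n j)) := rfl
  rw [hb, hb, e.left_inv hz.2, ← sesquilinear_sum_smul]
  simp only [symmDeriv_transition he he' hz, fderiv_transition_coordFrame, map_sum, map_smul]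

variable [IsManifold 𝓘(ℂ, Cn n) ω M]

theorem hessian_transition (hφ : ContMDiff 𝓘(ℝ, Cn n) 𝓘(ℝ, ℝ) ∞ φ)
    (he : e ∈ holCharts n M) (he' : e' ∈ holCharts n M)
    (hz : z ∈ e'.target ∩ e'.symm ⁻¹' e.source) :
    hessian (coordFrame n) (φ ∘ e'.symm) z = (transitionMatrix e e' z)ᴴ *
      hessian (coordFrame n) (φ ∘ e.symm) (e (e'.symm z)) * transitionMatrix e e' z := by
  have hopen := isOpen_transition_domain e e'
  have hφe := contDiffOn_comp_symm hφ he
  have hφ_eq : EqOn (fun w => ((φ ∘ e'.symm) w : ℂ))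
      (fun w => (((φ ∘ e.symm) ∘ e ∘ e'.symm) w : ℂ)) (e'.target ∩ e'.symm ⁻¹' e.source) :=
    fun w hw => congrArg (fun x => (φ x : ℂ)) (e.left_inv hw.2).symm
  calc hessian (coordFrame n) (φ ∘ e'.symm) z
      = hessian (coordFrame n) ((φ ∘ e.symm) ∘ e ∘ e'.symm) z :=
        Matrix.ext fun i j => wirt_congr hopen hz fun w hw => wirt_congr hopen hw hφ_eq
    _ = hessian (fun i => fderiv ℂ (e ∘ e'.symm) z (coordFrame n i)) (φ ∘ e.symm)
          (e (e'.symm z)) :=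
        hessian_comp_holomorphic e.open_target hφe hopen (contDiffOn_transition he he')
          (fun w hw => e.map_source hw.2) hz _
    _ = _ := by
        simp only [fderiv_transition_coordFrame]
        exact hessian_congruence e.open_target hφe (e.map_source hz.2) _ _

theorem traceMetricIn_transition (hφ : ContMDiff 𝓘(ℝ, Cn n) 𝓘(ℝ, ℝ) ∞ φ)
    (he : e ∈ holCharts n M) (he' : e' ∈ holCharts n M) {x : M} (hx : x ∈ e.source)
    (hx' : x ∈ e'.source) : g.traceMetricIn e' φ (e' x) = g.traceMetricIn e φ (e x) := by
  have hz : e' x ∈ e'.target ∩ e'.symm ⁻¹' e.source :=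
    ⟨e'.map_source hx', by rwa [mem_preimage, e'.left_inv hx']⟩
  have hG := coeff_transition g he he' hz
  have hH := hessian_transition hφ he he' hz
  rw [e'.left_inv hx'] at hG hH
  have hP : IsUnit (transitionMatrix e e' (e' x)) :=
    isUnit_of_mul_isUnit_right (hG ▸ (coeff_posDef g he' hz.1).isUnit)
  rw [traceMetricIn_eq_traceMetric, traceMetricIn_eq_traceMetric, traceMetric, traceMetric,
    perturbedMetric, perturbedMetric, hG, hH, ← add_mul, ← mul_add, trace_congruence_inv_mul hP]

theorem mongeAmpereOn_of_solvesMongeAmpere {g : HermitianMetric n M}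
    (hF : ContMDiff 𝓘(ℝ, Cn n) 𝓘(ℝ, ℝ) ∞ F) (hφ : ContMDiff 𝓘(ℝ, Cn n) 𝓘(ℝ, ℝ) ∞ φ)
    (hsol : g.SolvesMongeAmpere F φ) (he : e ∈ holCharts n M) :
    MongeAmpereOn e.target (coordFrame n) (g.coeff e) (φ ∘ e.symm) (F ∘ e.symm) where
  isOpen := e.open_target
  contDiffOn_metric := contDiffOn_coeff g he
  contDiffOn_potential := contDiffOn_comp_symm hφ he
  contDiffOn_logDensity := contDiffOn_comp_symm hF he
  posDef _ hz := coeff_posDef g he hz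
  posDef' z hz := coeff'_eq_perturbedMetric g φ e z ▸ (hsol e he z hz).1
  det_eq z hz := by
    rw [← coeff'_eq_perturbedMetric, det_eq_of_wedgePow_eq (hsol e he z hz).2, ofReal_exp,
      comp_apply]

end Metric

/-! ### The estimate on a compact manifold -/

section UniformJetBound

open scoped Matrix.Norms.L2Operator

variable {n : ℕ} {M : Type*} [TopologicalSpace M] [ChartedSpace (Cn n) M]
  {e : OpenPartialHomeomorph M (Cn n)}

theorem JetBound.mono {E ι : Type*} [Fintype ι] [DecidableEq ι] [NormedAddCommGroup E]
    [NormedSpace ℂ E] {G : E → Matrix ι ι ℂ} {p : E} {B B' : ℝ} (h : JetBound B G p)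
    (hB : B ≤ B') : JetBound B' G p :=
  ⟨h.1.trans hB, h.2.1.trans hB, h.2.2.trans hB⟩

theorem eventually_jetBound (g : HermitianMetric n M) (he : e ∈ holCharts n M) {x : M}
    (hx : x ∈ e.source) :
    ∃ B : ℝ, ∀ᶠ y in nhds x, y ∈ e.source ∧ JetBound B (g.coeff e) (e y) := by
  have hG := contDiffOn_coeff g he
  have hG1 := hG.fderiv_of_isOpen e.open_target (m := ∞) le_rfl
  have hG2 := hG1.fderiv_of_isOpen e.open_target (m := ∞) le_rfl
  have hGinv := contDiffOn_ringInverse hG fun z hz => (coeff_posDef g he hz).isUnit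
  have hcont : ContinuousOn (fun z => ‖(g.coeff e z)⁻¹ʳ‖ + ‖fderiv ℝ (g.coeff e) z‖ +
      ‖fderiv ℝ (fderiv ℝ (g.coeff e)) z‖) e.target :=
    (hGinv.continuousOn.norm.add hG1.continuousOn.norm).add hG2.continuousOn.norm
  have hcont_x := (hcont.continuousAt (e.open_target.mem_nhds (e.map_source hx))).comp
    (e.continuousAt hx)
  obtain ⟨B, hB⟩ := exists_gt (‖(g.coeff e (e x))⁻¹ʳ‖ + ‖fderiv ℝ (g.coeff e) (e x)‖ +
      ‖fderiv ℝ (fderiv ℝ (g.coeff e)) (e x)‖)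
  refine ⟨B, ?_⟩
  filter_upwards [e.open_source.mem_nhds hx, hcont_x.eventually_lt_const hB] with y hy h
  rw [comp_apply] at h
  refine ⟨hy, ?_, ?_, ?_⟩ <;>
    linarith [norm_nonneg ((g.coeff e (e y))⁻¹ʳ), norm_nonneg (fderiv ℝ (g.coeff e) (e y)),
      norm_nonneg (fderiv ℝ (fderiv ℝ (g.coeff e)) (e y))]

variable [IsManifold 𝓘(ℂ, Cn n) ω M]

theorem exists_uniform_jetBound [CompactSpace M] (g : HermitianMetric n M) :
    ∃ B : ℝ, 0 ≤ B ∧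
      ∀ x : M, ∃ e ∈ holCharts n M, x ∈ e.source ∧ JetBound B (g.coeff e) (e x) := by
  suffices h : ∃ B : ℝ, ∀ x ∈ (univ : Set M), ∃ e ∈ holCharts n M,
      x ∈ e.source ∧ JetBound B (g.coeff e) (e x) by
    obtain ⟨B, h⟩ := h
    refine ⟨max B 0, le_max_right B 0, fun x => ?_⟩
    obtain ⟨e, he, hxe, hB⟩ := h x (mem_univ x)
    exact ⟨e, he, hxe, hB.mono (le_max_left B 0)⟩
  refine isCompact_univ.induction_on ⟨0, by simp⟩
    (fun s t hst ⟨B, h⟩ => ⟨B, fun x hx => h x (hst hx)⟩) ?_ fun x _ => ?_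
  · rintro s t ⟨B, hs⟩ ⟨B', ht⟩
    refine ⟨max B B', ?_⟩
    rintro x (hx | hx)
    · obtain ⟨e, he, hxe, h⟩ := hs x hx
      exact ⟨e, he, hxe, h.mono (le_max_left _ _)⟩
    · obtain ⟨e, he, hxe, h⟩ := ht x hx
      exact ⟨e, he, hxe, h.mono (le_max_right _ _)⟩
  · have he := chartAt_mem_holCharts (n := n) x
    obtain ⟨B, hB⟩ := eventually_jetBound g he (mem_chart_source _ x)
    exact ⟨_, mem_nhdsWithin_of_mem_nhds hB, B, fun y hy => ⟨_, he, hy⟩⟩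

end UniformJetBound

section Trace

variable {n : ℕ} {M : Type*} [TopologicalSpace M] [ChartedSpace (Cn n) M]
  {e : OpenPartialHomeomorph M (Cn n)} {F φ : M → ℝ}

/-- The function `tr_g g'` on `M`, computed in the preferred chart at each point. -/
def globalTrace (g : HermitianMetric n M) (φ : M → ℝ) (x : M) : ℝ :=
  g.traceMetricIn (chartAt (Cn n) x) φ (chartAt (Cn n) x x)

variable [IsManifold 𝓘(ℂ, Cn n) ω M] {g : HermitianMetric n M}

theorem traceMetricIn_eq_globalTrace (hφ : ContMDiff 𝓘(ℝ, Cn n) 𝓘(ℝ, ℝ) ∞ φ)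
    (he : e ∈ holCharts n M) {x : M} (hx : x ∈ e.source) :
    g.traceMetricIn e φ (e x) = globalTrace g φ x :=
  traceMetricIn_transition g hφ (chartAt_mem_holCharts x) he (mem_chart_source _ x) hx

theorem traceMetric_chart_eq_globalTrace (hφ : ContMDiff 𝓘(ℝ, Cn n) 𝓘(ℝ, ℝ) ∞ φ)
    (he : e ∈ holCharts n M) {z : Cn n} (hz : z ∈ e.target) :
    traceMetric (coordFrame n) (g.coeff e) (φ ∘ e.symm) z = globalTrace g φ (e.symm z) := by
  rw [← traceMetricIn_eq_globalTrace hφ he (e.map_target hz), e.right_inv hz,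
    traceMetricIn_eq_traceMetric]

theorem globalTrace_pos [NeZero n] (hF : ContMDiff 𝓘(ℝ, Cn n) 𝓘(ℝ, ℝ) ∞ F)
    (hφ : ContMDiff 𝓘(ℝ, Cn n) 𝓘(ℝ, ℝ) ∞ φ) (hsol : g.SolvesMongeAmpere F φ) (x : M) :
    0 < globalTrace g φ x := by
  have he := chartAt_mem_holCharts (n := n) x
  rw [globalTrace, traceMetricIn_eq_traceMetric]
  exact (mongeAmpereOn_of_solvesMongeAmpere hF hφ hsol he).traceMetric_pos
    ((chartAt (Cn n) x).map_source (mem_chart_source _ x))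

theorem continuous_globalTrace (hF : ContMDiff 𝓘(ℝ, Cn n) 𝓘(ℝ, ℝ) ∞ F)
    (hφ : ContMDiff 𝓘(ℝ, Cn n) 𝓘(ℝ, ℝ) ∞ φ) (hsol : g.SolvesMongeAmpere F φ) :
    Continuous (globalTrace g φ) := by
  rw [continuous_iff_continuousAt]
  intro x
  set e := chartAt (Cn n) x
  have he : e ∈ holCharts n M := chartAt_mem_holCharts x
  have hx : x ∈ e.source := mem_chart_source _ x
  have hcont : ContinuousAt (traceMetric (coordFrame n) (g.coeff e) (φ ∘ e.symm)) (e x) :=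
    (mongeAmpereOn_of_solvesMongeAmpere hF hφ hsol he).contDiffOn_traceMetric.continuousOn
      |>.continuousAt (e.open_target.mem_nhds (e.map_source hx))
  refine (hcont.comp (e.continuousAt hx)).congr ?_
  filter_upwards [e.open_source.mem_nhds hx] with y hy
  rw [comp_apply, ← traceMetricIn_eq_traceMetric, traceMetricIn_eq_globalTrace hφ he hy]

end Trace

section GlobalEstimate

theorem iInf_le_apply_of_continuous {X : Type*} [TopologicalSpace X] [CompactSpace X] {φ : X → ℝ}
    (hφ : Continuous φ) (x : X) : ⨅ y, φ y ≤ φ x :=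
  ciInf_le (isCompact_range hφ).bddBelow x

theorem le_mul_sq_of_or {u s β C : ℝ} (hs : 1 ≤ s) (hβ : 0 ≤ β) (hC : 0 ≤ C)
    (h : s⁻¹ ^ 3 * u ^ 2 ≤ β ^ 2 ∨ u ≤ C) : u ≤ (β + C) * s ^ 2 := by
  rcases h with h | h
  · have h_sq : u ^ 2 ≤ (β * s ^ 2) ^ 2 := by
      rw [inv_pow, inv_mul_le_iff₀ (by positivity)] at h
      calc u ^ 2 ≤ s ^ 3 * β ^ 2 := h
        _ ≤ s ^ 4 * β ^ 2 := by gcongr; norm_num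
        _ = (β * s ^ 2) ^ 2 := by ring
    have hu : u ≤ β * s ^ 2 := (abs_le_of_sq_le_sq' h_sq (by positivity)).2
    nlinarith [mul_nonneg hC (sq_nonneg s)]
  · nlinarith [one_le_pow₀ (n := 2) hs, mul_nonneg hβ (sq_nonneg s)]

theorem sq_le_exp_mul {s A : ℝ} (hs : 1 ≤ s) (hA : 2 ≤ A) : s ^ 2 ≤ Real.exp (A * (s - 1)) :=
  calc s ^ 2 ≤ Real.exp (s - 1) ^ 2 :=
        pow_le_pow_left₀ (by linarith) (by linarith [Real.add_one_le_exp (s - 1)]) 2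
    _ = Real.exp (2 * (s - 1)) := by rw [← Real.exp_nat_mul, Nat.cast_ofNat]
    _ ≤ Real.exp (A * (s - 1)) := by gcongr

/-- If `tr_g g'` attains the maximum of the test function at a point, then it is there at most
this constant times the square of `φ - inf φ + 1`. -/
def maxPointConst (n : ℕ) (A B K : ℝ) : ℝ :=
  (A + 1) * (2 * n * (1 + B) ^ 3) + n * (Real.exp K * (1 + (A + 1) * n) ^ n)

theorem maxPointConst_pos {n : ℕ} [NeZero n] {A B K : ℝ} (hA : 0 ≤ A) (hB : 0 ≤ B) :
    0 < maxPointConst n A B K := by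
  have hn : (0 : ℝ) < n := Nat.cast_pos.2 (NeZero.pos n)
  unfold maxPointConst
  positivity

variable {n : ℕ} {M : Type*} [TopologicalSpace M] [ChartedSpace (Cn n) M]
  [IsManifold 𝓘(ℂ, Cn n) ω M] {g : HermitianMetric n M} {F φ : M → ℝ} {A B C K : ℝ}
  {e : OpenPartialHomeomorph M (Cn n)}

/-- The test function `log tr_g g' - Aφ + (φ - inf φ + 1)⁻¹` on `M`. -/
def testFunction (g : HermitianMetric n M) (φ : M → ℝ) (A : ℝ) (x : M) : ℝ :=
  Real.log (globalTrace g φ x) + barrier A (⨅ y, φ y) (φ x)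

variable [NeZero n] [CompactSpace M]

theorem exists_testFunction_le [Nonempty M] (hF : ContMDiff 𝓘(ℝ, Cn n) 𝓘(ℝ, ℝ) ∞ F)
    (hφ : ContMDiff 𝓘(ℝ, Cn n) 𝓘(ℝ, ℝ) ∞ φ) (hsol : g.SolvesMongeAmpere F φ) (A : ℝ) :
    ∃ p, ∀ x, testFunction g φ A x ≤ testFunction g φ A p := by
  have hlog : Continuous fun x => Real.log (globalTrace g φ x) :=
    (continuous_globalTrace hF hφ hsol).log fun x => (globalTrace_pos hF hφ hsol x).ne'
  have hbarrier : Continuous fun x => barrier A (⨅ y, φ y) (φ x) :=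
    continuous_iff_continuousAt.2 fun x =>
      have hx := iInf_le_apply_of_continuous hφ.continuous x
      (hasDerivAt_barrier (by linarith)).continuousAt.comp hφ.continuous.continuousAt
  obtain ⟨p, -, hp⟩ := isCompact_univ.exists_isMaxOn univ_nonempty (hlog.add hbarrier).continuousOn
  exact ⟨p, fun x => hp (mem_univ x)⟩

theorem globalTrace_le_of_testFunction_le (hF : ContMDiff 𝓘(ℝ, Cn n) 𝓘(ℝ, ℝ) ∞ F)
    (hφ : ContMDiff 𝓘(ℝ, Cn n) 𝓘(ℝ, ℝ) ∞ φ) (hsol : g.SolvesMongeAmpere F φ) {p : M}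
    (hFK : |F p| ≤ K) (hΔF : ∀ e ∈ holCharts n M, ∀ z ∈ e.target, -K ≤ g.laplacianIn e F z)
    (he : e ∈ holCharts n M) (hpe : p ∈ e.source) (hB : JetBound B (g.coeff e) (e p))
    (hA : MongeAmpereJet.laplacianConst n ((1 + B) ^ 3) K + 2 ≤ A)
    (hmax : ∀ x, testFunction g φ A x ≤ testFunction g φ A p) :
    globalTrace g φ p ≤ maxPointConst n A B K * (φ p - (⨅ x, φ x) + 1) ^ 2 := by
  have S := mongeAmpereOn_of_solvesMongeAmpere hF hφ hsol he
  have hp : e p ∈ e.target := e.map_source hpe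
  have hB0 : 0 ≤ B := hB.nonneg
  have hA0 : 0 ≤ A := by
    linarith [MongeAmpereJet.laplacianConst_nonneg n (pow_nonneg (add_nonneg zero_le_one hB0) 3)
      ((abs_nonneg _).trans hFK)]
  have hloc : IsLocalMax (fun z =>
      Real.log (traceMetric (coordFrame n) (g.coeff e) (φ ∘ e.symm) z) +
        barrier A (⨅ x, φ x) ((φ ∘ e.symm) z)) (e p) := by
    filter_upwards [e.open_target.mem_nhds hp] with z hz
    rw [traceMetric_chart_eq_globalTrace hφ he hz, traceMetric_chart_eq_globalTrace hφ he hp,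
      comp_apply, comp_apply, e.left_inv hpe]
    exact hmax (e.symm z)
  have hest := S.traceMetric_le_of_isLocalMax hp
    (fun c => (congrArg norm (eq_sum_smul_coordFrame c)).ge) hB
    (K := K) (by rwa [comp_apply, e.left_inv hpe]) (laplacianIn_eq g F e _ ▸ hΔF e he _ hp)
    (fun z _ => iInf_le_apply_of_continuous hφ.continuous _) (by rwa [Fintype.card_fin]) hloc
  rw [traceMetric_chart_eq_globalTrace hφ he hp, comp_apply, e.left_inv hpe,
    Fintype.card_fin] at hest
  have hmp := iInf_le_apply_of_continuous hφ.continuous p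
  exact le_mul_sq_of_or (by linarith) (by positivity) (by positivity) hest

theorem globalTrace_le_of_le_at_max (hF : ContMDiff 𝓘(ℝ, Cn n) 𝓘(ℝ, ℝ) ∞ F)
    (hφ : ContMDiff 𝓘(ℝ, Cn n) 𝓘(ℝ, ℝ) ∞ φ) (hsol : g.SolvesMongeAmpere F φ) {p : M}
    (hA : 2 ≤ A) (hC : 0 ≤ C) (hmax : ∀ x, testFunction g φ A x ≤ testFunction g φ A p)
    (hp : globalTrace g φ p ≤ C * (φ p - (⨅ x, φ x) + 1) ^ 2) (x : M) :
    globalTrace g φ x ≤ Real.exp 1 * C * Real.exp (A * (φ x - ⨅ y, φ y)) := by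
  set m := ⨅ y, φ y
  have hm (y : M) : m ≤ φ y := iInf_le_apply_of_continuous hφ.continuous y
  have hlog : Real.log (globalTrace g φ x) ≤
      Real.log (globalTrace g φ p) + (1 + A * (φ x - φ p)) := by
    have hx : 0 < (φ x - m + 1)⁻¹ := inv_pos.2 (by linarith [hm x])
    have hp : (φ p - m + 1)⁻¹ ≤ 1 := inv_le_one_of_one_le₀ (by linarith [hm p])
    have h := hmax x
    simp only [testFunction, barrier] at h
    linarith
  calc globalTrace g φ x = Real.exp (Real.log (globalTrace g φ x)) :=
        (Real.exp_log (globalTrace_pos hF hφ hsol x)).symm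
    _ ≤ Real.exp (Real.log (globalTrace g φ p) + (1 + A * (φ x - φ p))) := Real.exp_le_exp.2 hlog
    _ = globalTrace g φ p * Real.exp (1 + A * (φ x - φ p)) := by
        rw [Real.exp_add, Real.exp_log (globalTrace_pos hF hφ hsol p)]
    _ ≤ C * Real.exp (A * (φ p - m)) * Real.exp (1 + A * (φ x - φ p)) := by
        have h := sq_le_exp_mul (s := φ p - m + 1) (by linarith [hm p]) hA
        rw [add_sub_cancel_right] at h
        gcongr
        exact hp.trans (by gcongr)
    _ = Real.exp 1 * C * Real.exp (A * (φ x - m)) := by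
        rw [mul_comm _ C, mul_assoc, mul_assoc, ← Real.exp_add, ← Real.exp_add]
        ring_nf

end GlobalEstimate

end HermitianMA

end

open HermitianMA in
theorem theorem2p1_general {n : ℕ} {M : Type*} [TopologicalSpace M] [CompactSpace M]
    [ChartedSpace (Cn n) M] [IsManifold 𝓘(ℂ, Cn n) ω M] (g : HermitianMetric n M) (K : ℝ) :
    ∃ C A : ℝ, 0 < C ∧ 0 < A ∧
      ∀ F φ : M → ℝ,
        ContMDiff 𝓘(ℝ, Cn n) 𝓘(ℝ, ℝ) ∞ F →
        ContMDiff 𝓘(ℝ, Cn n) 𝓘(ℝ, ℝ) ∞ φ →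
        (∀ x, |F x| ≤ K) →
        (∀ e ∈ holCharts n M, ∀ z ∈ e.target, -K ≤ g.laplacianIn e F z) →
        g.SolvesMongeAmpere F φ →
        ∀ e ∈ holCharts n M, ∀ x ∈ e.source,
          g.traceMetricIn e φ (e x) ≤ C * Real.exp (A * (φ x - ⨅ y, φ y)) := by
  rcases Nat.eq_zero_or_pos n with rfl | hn
  · refine ⟨1, 1, one_pos, one_pos, fun F φ _ _ _ _ _ e _ x _ => ?_⟩
    rw [traceMetricIn_eq_traceMetric, traceMetric, Matrix.trace_fin_zero, Complex.zero_re]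
    positivity
  have : NeZero n := ⟨hn.ne'⟩
  obtain ⟨B, hB0, hB⟩ := exists_uniform_jetBound g
  set A : ℝ := MongeAmpereJet.laplacianConst n ((1 + B) ^ 3) |K| + 2 with hA
  have hA2 : 2 ≤ A := by
    linarith [MongeAmpereJet.laplacianConst_nonneg n (B := (1 + B) ^ 3) (by positivity)
      (abs_nonneg K)]
  have hC : 0 < maxPointConst n A B |K| := maxPointConst_pos (by linarith) hB0
  refine ⟨Real.exp 1 * maxPointConst n A B |K|, A, by positivity, by linarith,
    fun F φ hF hφ hFK hΔF hsol e he x hx => ?_⟩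
  have : Nonempty M := ⟨x⟩
  obtain ⟨p, hmax⟩ := exists_testFunction_le hF hφ hsol A
  obtain ⟨e', he', hp, hBp⟩ := hB p
  have hpC := globalTrace_le_of_testFunction_le hF hφ hsol ((hFK p).trans (le_abs_self K))
    (fun e he z hz => (neg_le_neg (le_abs_self K)).trans (hΔF e he z hz)) he' hp hBp hA.ge hmax
  rw [traceMetricIn_eq_globalTrace hφ he hx]
  exact globalTrace_le_of_le_at_max hF hφ hsol hA2 hC.le hmax hpC x

open HermitianMA in
theorem theorem2p1 {n : ℕ} {M : Type*} [TopologicalSpace M] [T2Space M] [CompactSpace M]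
    [ChartedSpace (Cn n) M] [IsManifold 𝓘(ℂ, Cn n) ω M]
    (g : HermitianMetric n M)
    (hn : n = 2 ∨ (2 < n ∧ g.IsBalanced)) (K : ℝ) :
    ∃ C A : ℝ, 0 < C ∧ 0 < A ∧
      ∀ F φ : M → ℝ,
        ContMDiff 𝓘(ℝ, Cn n) 𝓘(ℝ, ℝ) ∞ F →
        ContMDiff 𝓘(ℝ, Cn n) 𝓘(ℝ, ℝ) ∞ φ →
        (∀ x, |F x| ≤ K) →
        (∀ e ∈ holCharts n M, ∀ z ∈ e.target, |g.laplacianIn e F z| ≤ K) →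
        g.SolvesMongeAmpere F φ →
        ⨆ x, φ x = 0 →
        ∀ e ∈ holCharts n M, ∀ x ∈ e.source,
          g.traceMetricIn e φ (e x) ≤ C * Real.exp (A * (φ x - ⨅ y, φ y)) := by
  obtain ⟨C, A, hC, hA, h⟩ := theorem2p1_general g K
  exact ⟨C, A, hC, hA, fun F φ hF hφ hFK hΔF hsol _ =>
    h F φ hF hφ hFK (fun e he z hz => neg_le_of_abs_le (hΔF e he z hz)) hsol⟩
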